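/- \textbf{Theorem (Adequacy Theorem).} \emph{Formulas.} Fix a first-order language $\mathcal L$ with individual variables $\alpha,\beta,\dots$. Formulas are built from atomic formulas, including the $0$-ary atom $\bot$, by $\land,\lor,\to,\forall,\exists$. Individual terms are denoted by $m$. \emph{Proof terms of $\mathsf{LC}$} are the Church-typed terms, up to $\alpha$-equivalence, given by the rules of intuitionistic natural deduction together with Dummett's rule: variables $x^A:A$; pairs $\langle u,t\rangle$ and projections $u\,\pi_0,u\,\pi_1$ for $\land$; $\lambda x^A u$ and $t\,u$ for $\to$; $\iota_0(u),\iota_1(u)$ and $u\,[x^A.w_1,y^B.w_2]$ for $\lor$; $\lambda\alpha\,u$ (with $\alpha$ not free in the types of the free variables of $u$) and $u\,m$ for $\forall$; $(m,u)$ and $u\,[(\alpha,x^A).t]$ (with $t:C$, and $\alpha$ free neither in $C$ nor in the types of the free variables of $t$ other than $x^A$) for $\exists$; $\mathsf{efq}_P(u):P$ for $u:\bot$ and $P$ atomic; and $u\parallel_a v:C$, whenever $u:C$ with $a$ of type $A\to B$ in $u$, and $v:C$ with $a$ of type $B\to A$ in $v$ ($a$ is bound in both). Injections $\iota_i$ and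 pairs $(m,u)$ carry type annotations, so that types are unique. The calculus $\mathsf{LC}^\star$ is $\mathsf{LC}$ plus constants $\mathcal A^{A\to B}:A\to B$ for all formulas $A,B$. A \emph{stack} $\sigma$ is a finite sequence of proof terms, individual terms, $\pi_0$, $\pi_1$, $[x.u,y.v]$ and $[(\alpha,x).v]$; the empty stack is $\epsilon$, and $t\,\sigma=(((t\,\sigma_1)\sigma_2)\cdots\sigma_n)$. \emph{Head reduction.} The basic reductions of $\mathsf{LC}^\star$ are: $(\lambda x\,u)t\mapsto u[t/x]$; $(\lambda\alpha\,u)m\mapsto u[m/\alpha]$; $\langle u_0,u_1\rangle\pi_i\mapsto u_i$; $\iota_i(u)[x_0.t_0,x_1.t_1]\mapsto t_i[u/x_i]$; $(m,u)[(\alpha,x).v]\mapsto v[m/\alpha][u/x]$; $(u\parallel_a v)\,\xi\mapsto u\,\xi\parallel_a v\,\xi$ for every stack $\xi$ of length one in which $a$ is not free; $\mathcal C[a\,u\,\sigma]\parallel_a v\mapsto\mathcal C[v[\lambda y\,u/a]]\parallel_a v$ and $v\parallel_a\mathcal C[a\,u\,\sigma]\mapsto v\parallel_a\mathcal C[v[\lambda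 y\,u/a]]$, where $\mathcal C$ is a parallel context (a hole, $\mathcal C'\parallel_b w$ or $w\parallel_b\mathcal C'$ with $\mathcal C'$ a parallel context) that does not bind $a$ or capture variables of $v$, and $y$ is fresh; and $\mathcal A\,u\,\sigma\mapsto u$ if $\mathcal A\,u\,\sigma$ and $u$ have the same type. The parallel processes of $t$ are $t$ itself and, if $t=u\parallel_a v$, those of $u$ and of $v$; they are elementary if not of the form $u\parallel_a v$. The head redex of a term is: the redex $r$ itself in $r\,\sigma$, if $r$ is a redex of one of the first six kinds; all of $\mathcal A\,u\,\sigma$, if it is a redex; all of $u\parallel_a v$, if it is a redex. In the last case the redex starts at the leftmost of its elementary processes of the form $a\,w\,\rho$, and that occurrence is the one replaced; in the other cases it starts where it stands. Head reduction $t\succ t'$ contracts the leftmost (by starting point) among the head redexes of the parallel processes of $t$. Let $\mathsf{HN}^\star$ be the set of proof terms of $\mathsf{LC}^\star$ with no infinite $\succ$-sequence. \emph{Realizability.} A stack $\tau$ is adapted to $C$ if $t\,\tau$ is a proof term of $\mathsf{LC}^\star$ for all $t:C$ in $\mathsf{LC}^\star$. For terms $t$ of $\mathsf{LC}^\star$ (possibly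 with free variables) define, by recursion on $C$: $t\Vdash C$ iff $t:C$ in $\mathsf{LC}^\star$ and $t\,\sigma\in\mathsf{HN}^\star$ for all $\sigma\in\|C\|$, where \begin{itemize} \item $\|P\|=\{\epsilon\}$ for $P$ atomic; \item $\|A\to B\|=\{u\cdot\sigma\mid u\Vdash A,\ \sigma\in\|B\|\}\cup\{\epsilon\}$; \item $\|A\land B\|=\{\pi_0\cdot\sigma\mid\sigma\in\|A\|\}\cup\{\pi_1\cdot\sigma\mid\sigma\in\|B\|\}\cup\{\epsilon\}$; \item $\|A\lor B\|$ consists of $\epsilon$ and the stacks $[x^A.u,y^B.v]\cdot\sigma$ adapted to $A\lor B$ such that for all $t$: $t\Vdash A$ implies $u[t/x]\,\sigma\in\mathsf{HN}^\star$, and $t\Vdash B$ implies $v[t/y]\,\sigma\in\mathsf{HN}^\star$; \item $\|\forall\alpha\,A\|=\{m\cdot\sigma\mid m\text{ an individual term},\ \sigma\in\|A[m/\alpha]\|\}\cup\{\epsilon\}$; \item $\|\exists\alpha\,A\|$ consists of $\epsilon$ and the stacks $[(\alpha,x^A).v]\cdot\sigma$ adapted to $\exists\alpha\,A$ such that for all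 individual terms $m$ and all $t\Vdash A[m/\alpha]$: $v[m/\alpha][t/x]\,\sigma\in\mathsf{HN}^\star$. \end{itemize} \emph{Statement.} Suppose that $w:A$ in $\mathsf{LC}$, with the free proof-term variables of $w$ among $x_1^{A_1},\dots,x_n^{A_n}$. Let $r_1,\dots,r_k$ be individual terms, $\alpha_1,\dots,\alpha_k$ distinct individual variables, and write $\overline B=B[r_1/\alpha_1\cdots r_k/\alpha_k]$. If $t_1,\dots,t_n$ are terms of $\mathsf{LC}^\star$ with $t_i\Vdash\overline{A_i}$ for $i=1,\dots,n$, then $$w[r_1/\alpha_1\cdots r_k/\alpha_k][t_1/x_1^{\overline{A_1}}\cdots t_n/x_n^{\overline{A_n}}]\Vdash\overline A ,$$ where all substitutions are simultaneous and capture-avoiding, and $t_i$ replaces the variable that was $x_i^{A_i}$ in $w$. -/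

import Mathlib

/-!
The calculi `LC` and `LC*` of first-order Dummett logic. Both individual variables and
proof-term variables are represented by de Bruijn indices, so that terms are taken up to
alpha-equivalence. Individual terms are the terms `L.Term ℕ` of a first-order language `L`.
-/

namespace DummettLC

universe u v

/-- The sequence `x, f 0, f 1, f 2, …`. -/
def scons {α : Type*} (x : α) (f : ℕ → α) : ℕ → α
  | 0 => x
  | n + 1 => f n

/-- Lifting of an individual substitution under a binder for individual variables. -/
def upI {L : FirstOrder.Language.{u, v}} (ρ : ℕ → L.Term ℕ) : ℕ → L.Term ℕ :=
  scons (FirstOrder.Language.Term.var 0) (fun n => (ρ n).relabel Nat.succ)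

/-- Formulas. The language has, besides the predicate symbols of `L`, the `0`-ary predicate
symbol `⊥`. The quantifiers bind the individual variable `0` of their body. -/
inductive Formula (L : FirstOrder.Language.{u, v}) : Type (max u v)
  | bot : Formula L
  | rel {n : ℕ} (P : L.Relations n) (ms : Fin n → L.Term ℕ) : Formula L
  | and (A B : Formula L) : Formula L
  | or (A B : Formula L) : Formula L
  | imp (A B : Formula L) : Formula L
  | all (A : Formula L) : Formula L
  | ex (A : Formula L) : Formula L

namespace Formula

variable {L : FirstOrder.Language.{u, v}}

/-- Atomic formulas; `⊥` is one of them. -/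
def IsAtomic : Formula L → Prop
  | bot => True
  | rel _ _ => True
  | _ => False

/-- Simultaneous capture-avoiding substitution of individual terms for individual variables. -/
def subst : (ℕ → L.Term ℕ) → Formula L → Formula L
  | _, bot => bot
  | ρ, rel P ms => rel P (fun i => (ms i).subst ρ)
  | ρ, and A B => and (A.subst ρ) (B.subst ρ)
  | ρ, or A B => or (A.subst ρ) (B.subst ρ)
  | ρ, imp A B => imp (A.subst ρ) (B.subst ρ)
  | ρ, all A => all (A.subst (upI ρ))
  | ρ, ex A => ex (A.subst (upI ρ))

/-- `A[m/α]`, where `α` is the variable bound by a quantifier with body `A`. -/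
def inst (A : Formula L) (m : L.Term ℕ) : Formula L :=
  A.subst (scons m FirstOrder.Language.Term.var)

/-- `A` seen in the scope of one more individual variable `α`, which does not occur in it. -/
def shift (A : Formula L) : Formula L :=
  A.subst (fun n => FirstOrder.Language.Term.var (n + 1))

/-- Number of logical constants. -/
def size : Formula L → ℕ
  | bot => 0
  | rel _ _ => 0
  | and A B => A.size + B.size + 1
  | or A B => A.size + B.size + 1
  | imp A B => A.size + B.size + 1
  | all A => A.size + 1
  | ex A => A.size + 1

theorem size_subst (A : Formula L) : ∀ ρ : ℕ → L.Term ℕ, (A.subst ρ).size = A.size := by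
  induction A <;> intro ρ <;> simp_all [subst, size]

theorem size_inst (A : Formula L) (m : L.Term ℕ) : (A.inst m).size = A.size :=
  size_subst A _

end Formula

/-- Raw Church-style proof terms of `LC*`. The comments give the usual notation. The type
annotations make the type of a proof term unique. -/
inductive PTerm (L : FirstOrder.Language.{u, v}) : Type (max u v)
  /-- the variable with index `i` -/
  | var (i : ℕ) : PTerm L
  /-- `⟨s, t⟩` -/
  | pair (s t : PTerm L) : PTerm L
  /-- `t π₀` -/
  | fst (t : PTerm L) : PTerm L
  /-- `t π₁` -/
  | snd (t : PTerm L) : PTerm L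
  /-- `t s` -/
  | app (t s : PTerm L) : PTerm L
  /-- `λ x^A t` -/
  | lam (A : Formula L) (t : PTerm L) : PTerm L
  /-- `ι₀(t) : A ∨ B` for `t : A` -/
  | inl (B : Formula L) (t : PTerm L) : PTerm L
  /-- `ι₁(t) : A ∨ B` for `t : B` -/
  | inr (A : Formula L) (t : PTerm L) : PTerm L
  /-- `t [x^A. w₁, y^B. w₂]` -/
  | orElim (t : PTerm L) (A : Formula L) (w₁ : PTerm L) (B : Formula L) (w₂ : PTerm L) : PTerm L
  /-- `t m` -/
  | iapp (t : PTerm L) (m : L.Term ℕ) : PTerm L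
  /-- `λ α t` -/
  | ilam (t : PTerm L) : PTerm L
  /-- `(m, t) : ∃ α A` -/
  | pack (A : Formula L) (m : L.Term ℕ) (t : PTerm L) : PTerm L
  /-- `t [(α, x^A). w]`; `A` is in the scope of `α`, and `w` in that of `α` and `x` -/
  | unpack (t : PTerm L) (A : Formula L) (w : PTerm L) : PTerm L
  /-- `s ∥_a t`, where `a` is bound with type `A → B` in `s` and with type `B → A` in `t` -/
  | par (A B : Formula L) (s t : PTerm L) : PTerm L
  /-- `efq_P(t)` -/
  | efq (P : Formula L) (t : PTerm L) : PTerm L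
  /-- the abort constant of type `A → B` -/
  | abort (A B : Formula L) : PTerm L

namespace PTerm

variable {L : FirstOrder.Language.{u, v}}

/-- Lifting of a renaming of proof-term variables under a binder. -/
def upRen (ξ : ℕ → ℕ) : ℕ → ℕ := scons 0 (fun n => ξ n + 1)

/-- Renaming of the free proof-term variables. -/
def rename : (ℕ → ℕ) → PTerm L → PTerm L
  | ξ, var i => var (ξ i)
  | ξ, pair s t => pair (s.rename ξ) (t.rename ξ)
  | ξ, fst t => fst (t.rename ξ)
  | ξ, snd t => snd (t.rename ξ)
  | ξ, app t s => app (t.rename ξ) (s.rename ξ)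
  | ξ, lam A t => lam A (t.rename (upRen ξ))
  | ξ, inl B t => inl B (t.rename ξ)
  | ξ, inr A t => inr A (t.rename ξ)
  | ξ, orElim t A w₁ B w₂ =>
      orElim (t.rename ξ) A (w₁.rename (upRen ξ)) B (w₂.rename (upRen ξ))
  | ξ, iapp t m => iapp (t.rename ξ) m
  | ξ, ilam t => ilam (t.rename ξ)
  | ξ, pack A m t => pack A m (t.rename ξ)
  | ξ, unpack t A w => unpack (t.rename ξ) A (w.rename (upRen ξ))
  | ξ, par A B s t => par A B (s.rename (upRen ξ)) (t.rename (upRen ξ))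
  | ξ, efq P t => efq P (t.rename ξ)
  | _, abort A B => abort A B

/-- `t` seen in the scope of one more proof-term variable, which does not occur in it. -/
def shift (t : PTerm L) : PTerm L := t.rename Nat.succ

/-- Simultaneous capture-avoiding substitution of individual terms for the free individual
variables, in the term and in all type annotations. -/
def substI : (ℕ → L.Term ℕ) → PTerm L → PTerm L
  | _, var i => var i
  | ρ, pair s t => pair (s.substI ρ) (t.substI ρ)
  | ρ, fst t => fst (t.substI ρ)
  | ρ, snd t => snd (t.substI ρ)
  | ρ, app t s => app (t.substI ρ) (s.substI ρ)
  | ρ, lam A t => lam (A.subst ρ) (t.substI ρ)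
  | ρ, inl B t => inl (B.subst ρ) (t.substI ρ)
  | ρ, inr A t => inr (A.subst ρ) (t.substI ρ)
  | ρ, orElim t A w₁ B w₂ =>
      orElim (t.substI ρ) (A.subst ρ) (w₁.substI ρ) (B.subst ρ) (w₂.substI ρ)
  | ρ, iapp t m => iapp (t.substI ρ) (m.subst ρ)
  | ρ, ilam t => ilam (t.substI (upI ρ))
  | ρ, pack A m t => pack (A.subst (upI ρ)) (m.subst ρ) (t.substI ρ)
  | ρ, unpack t A w => unpack (t.substI ρ) (A.subst (upI ρ)) (w.substI (upI ρ))
  | ρ, par A B s t => par (A.subst ρ) (B.subst ρ) (s.substI ρ) (t.substI ρ)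
  | ρ, efq P t => efq (P.subst ρ) (t.substI ρ)
  | ρ, abort A B => abort (A.subst ρ) (B.subst ρ)

/-- `t` seen in the scope of one more individual variable, which does not occur in it. -/
def shiftI (t : PTerm L) : PTerm L := t.substI (fun n => FirstOrder.Language.Term.var (n + 1))

/-- Lifting of a substitution under a binder for a proof-term variable. -/
def upS (s : ℕ → PTerm L) : ℕ → PTerm L := scons (var 0) (fun n => (s n).shift)

/-- Simultaneous capture-avoiding substitution of proof terms for proof-term variables. -/
def subst : (ℕ → PTerm L) → PTerm L → PTerm L
  | τ, var i => τ i
  | τ, pair s t => pair (s.subst τ) (t.subst τ)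
  | τ, fst t => fst (t.subst τ)
  | τ, snd t => snd (t.subst τ)
  | τ, app t s => app (t.subst τ) (s.subst τ)
  | τ, lam A t => lam A (t.subst (upS τ))
  | τ, inl B t => inl B (t.subst τ)
  | τ, inr A t => inr A (t.subst τ)
  | τ, orElim t A w₁ B w₂ =>
      orElim (t.subst τ) A (w₁.subst (upS τ)) B (w₂.subst (upS τ))
  | τ, iapp t m => iapp (t.subst τ) m
  | τ, ilam t => ilam (t.subst (fun n => (τ n).shiftI))
  | τ, pack A m t => pack A m (t.subst τ)
  | τ, unpack t A w =>
      unpack (t.subst τ) A (w.subst (upS (fun n => (τ n).shiftI)))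
  | τ, par A B s t => par A B (s.subst (upS τ)) (t.subst (upS τ))
  | τ, efq P t => efq P (t.subst τ)
  | _, abort A B => abort A B

/-- `t[s/x]`, where `x` is the variable of a binder with body `t`. -/
def inst (t s : PTerm L) : PTerm L := t.subst (scons s var)

/-- `t[m/α]`, where `α` is the variable of an individual binder with body `t`. -/
def instI (t : PTerm L) (m : L.Term ℕ) : PTerm L := t.substI (scons m FirstOrder.Language.Term.var)

/-- The set of free proof-term variables. -/
def fv : PTerm L → Set ℕ
  | var i => {i}
  | pair s t => s.fv ∪ t.fv
  | fst t => t.fv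
  | snd t => t.fv
  | app t s => t.fv ∪ s.fv
  | lam _ t => {i | i + 1 ∈ t.fv}
  | inl _ t => t.fv
  | inr _ t => t.fv
  | orElim t _ w₁ _ w₂ => t.fv ∪ {i | i + 1 ∈ w₁.fv} ∪ {i | i + 1 ∈ w₂.fv}
  | iapp t _ => t.fv
  | ilam t => t.fv
  | pack _ _ t => t.fv
  | unpack t _ w => t.fv ∪ {i | i + 1 ∈ w.fv}
  | par _ _ s t => {i | i + 1 ∈ s.fv} ∪ {i | i + 1 ∈ t.fv}
  | efq _ t => t.fv
  | abort _ _ => ∅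

/-- The number of elementary processes of a term. -/
def procs : PTerm L → ℕ
  | par _ _ s t => s.procs + t.procs
  | _ => 1

end PTerm

/-- The two type systems: `LC`, and its extension `LC*` by the abort constants. -/
inductive System
  | LC
  | LCstar

/-- An assignment of types to the proof-term variables. -/
abbrev Ctx (L : FirstOrder.Language.{u, v}) : Type (max u v) := ℕ → Formula L

/-- Term assignment: `HasType S Γ t A` says that `t` is a proof term of type `A` of the system
`S`, where `Γ` gives the types of the free variables. In the rules for `ilam` and `unpack` the
side condition on the individual variable `α` is expressed by shifting. -/
inductive HasType {L : FirstOrder.Language.{u, v}} (S : System) : Ctx L → PTerm L → Formula L → Prop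
  | var (Γ : Ctx L) (i : ℕ) : HasType S Γ (.var i) (Γ i)
  | pair {Γ : Ctx L} {s t : PTerm L} {A B : Formula L} :
      HasType S Γ s A → HasType S Γ t B → HasType S Γ (.pair s t) (.and A B)
  | fst {Γ : Ctx L} {t : PTerm L} {A B : Formula L} :
      HasType S Γ t (.and A B) → HasType S Γ (.fst t) A
  | snd {Γ : Ctx L} {t : PTerm L} {A B : Formula L} :
      HasType S Γ t (.and A B) → HasType S Γ (.snd t) B
  | app {Γ : Ctx L} {t s : PTerm L} {A B : Formula L} :
      HasType S Γ t (.imp A B) → HasType S Γ s A → HasType S Γ (.app t s) B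
  | lam {Γ : Ctx L} {t : PTerm L} {A B : Formula L} :
      HasType S (scons A Γ) t B → HasType S Γ (.lam A t) (.imp A B)
  | inl {Γ : Ctx L} {t : PTerm L} {A B : Formula L} :
      HasType S Γ t A → HasType S Γ (.inl B t) (.or A B)
  | inr {Γ : Ctx L} {t : PTerm L} {A B : Formula L} :
      HasType S Γ t B → HasType S Γ (.inr A t) (.or A B)
  | orElim {Γ : Ctx L} {t w₁ w₂ : PTerm L} {A B C : Formula L} :
      HasType S Γ t (.or A B) → HasType S (scons A Γ) w₁ C → HasType S (scons B Γ) w₂ C →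
      HasType S Γ (.orElim t A w₁ B w₂) C
  | iapp {Γ : Ctx L} {t : PTerm L} {A : Formula L} (m : L.Term ℕ) :
      HasType S Γ t (.all A) → HasType S Γ (.iapp t m) (A.inst m)
  | ilam {Γ : Ctx L} {t : PTerm L} {A : Formula L} :
      HasType S (fun i => (Γ i).shift) t A → HasType S Γ (.ilam t) (.all A)
  | pack {Γ : Ctx L} {t : PTerm L} {A : Formula L} (m : L.Term ℕ) :
      HasType S Γ t (A.inst m) → HasType S Γ (.pack A m t) (.ex A)
  | unpack {Γ : Ctx L} {t w : PTerm L} {A C : Formula L} :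
      HasType S Γ t (.ex A) → HasType S (scons A (fun i => (Γ i).shift)) w C.shift →
      HasType S Γ (.unpack t A w) C
  | par {Γ : Ctx L} {s t : PTerm L} {A B C : Formula L} :
      HasType S (scons (.imp A B) Γ) s C → HasType S (scons (.imp B A) Γ) t C →
      HasType S Γ (.par A B s t) C
  | efq {Γ : Ctx L} {t : PTerm L} {P : Formula L} :
      P.IsAtomic → HasType S Γ t .bot → HasType S Γ (.efq P t) P
  | abort (Γ : Ctx L) (A B : Formula L) :
      S = System.LCstar → HasType S Γ (.abort A B) (.imp A B)

/-- The entries of a stack. -/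
inductive Frame (L : FirstOrder.Language.{u, v}) : Type (max u v)
  /-- a proof term `s` -/
  | app (s : PTerm L) : Frame L
  /-- an individual term `m` -/
  | iapp (m : L.Term ℕ) : Frame L
  /-- `π₀` -/
  | fst : Frame L
  /-- `π₁` -/
  | snd : Frame L
  /-- `[x^A. w₁, y^B. w₂]` -/
  | orElim (A : Formula L) (w₁ : PTerm L) (B : Formula L) (w₂ : PTerm L) : Frame L
  /-- `[(α, x^A). w]` -/
  | unpack (A : Formula L) (w : PTerm L) : Frame L

/-- A frame seen in the scope of one more proof-term variable, which does not occur in it. -/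
def Frame.shift {L : FirstOrder.Language.{u, v}} : Frame L → Frame L
  | .app s => .app s.shift
  | .iapp m => .iapp m
  | .fst => .fst
  | .snd => .snd
  | .orElim A w₁ B w₂ =>
      .orElim A (w₁.rename (PTerm.upRen Nat.succ)) B (w₂.rename (PTerm.upRen Nat.succ))
  | .unpack A w => .unpack A (w.rename (PTerm.upRen Nat.succ))

/-- `t ξ`, for a stack `ξ` of length one. -/
def PTerm.plug {L : FirstOrder.Language.{u, v}} (t : PTerm L) : Frame L → PTerm L
  | .app s => .app t s
  | .iapp m => .iapp t m
  | .fst => .fst t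
  | .snd => .snd t
  | .orElim A w₁ B w₂ => .orElim t A w₁ B w₂
  | .unpack A w => .unpack t A w

/-- Stacks. -/
abbrev Stack (L : FirstOrder.Language.{u, v}) : Type (max u v) := List (Frame L)

/-- `t σ = (((t σ₁) σ₂) … σₙ)`. -/
def PTerm.plugs {L : FirstOrder.Language.{u, v}} (t : PTerm L) (σ : Stack L) : PTerm L :=
  σ.foldl PTerm.plug t

/-- Parallel contexts. -/
inductive PCtx (L : FirstOrder.Language.{u, v}) : Type (max u v)
  | hole : PCtx L
  /-- `C[ ] ∥_a t` -/
  | left (A B : Formula L) (C : PCtx L) (t : PTerm L) : PCtx L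
  /-- `s ∥_a C[ ]` -/
  | right (A B : Formula L) (s : PTerm L) (C : PCtx L) : PCtx L

namespace PCtx

variable {L : FirstOrder.Language.{u, v}}

/-- `C[t]`, where `t` is in the scope of the variables that `C` binds at its hole. -/
def fill : PCtx L → PTerm L → PTerm L
  | hole, t => t
  | left A B C r, t => .par A B (C.fill t) r
  | right A B s C, t => .par A B s (C.fill t)

/-- The number of variables that `C` binds at its hole. -/
def depth : PCtx L → ℕ
  | hole => 0
  | left _ _ C _ => C.depth + 1
  | right _ _ _ C => C.depth + 1

/-- The types of the variables at the hole of `C`. -/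
def ctx : PCtx L → Ctx L → Ctx L
  | hole, Γ => Γ
  | left A B C _, Γ => C.ctx (scons (.imp A B) Γ)
  | right A B _ C, Γ => C.ctx (scons (.imp B A) Γ)

/-- The number of elementary processes to the left of the hole of `C`. -/
def before : PCtx L → ℕ
  | hole => 0
  | left _ _ C _ => C.before
  | right _ _ s C => s.procs + C.before

end PCtx

/-- The reduction rules for intuitionistic logic and the permutation rules for `∥`. -/
inductive Basic {L : FirstOrder.Language.{u, v}} : PTerm L → PTerm L → Prop
  | beta (A : Formula L) (t s : PTerm L) : Basic (.app (.lam A t) s) (t.inst s)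
  | betaI (t : PTerm L) (m : L.Term ℕ) : Basic (.iapp (.ilam t) m) (t.instI m)
  | fst (s t : PTerm L) : Basic (.fst (.pair s t)) s
  | snd (s t : PTerm L) : Basic (.snd (.pair s t)) t
  | inl (B' : Formula L) (t : PTerm L) (A : Formula L) (w₁ : PTerm L) (B : Formula L)
      (w₂ : PTerm L) : Basic (.orElim (.inl B' t) A w₁ B w₂) (w₁.inst t)
  | inr (A' : Formula L) (t : PTerm L) (A : Formula L) (w₁ : PTerm L) (B : Formula L)
      (w₂ : PTerm L) : Basic (.orElim (.inr A' t) A w₁ B w₂) (w₂.inst t)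
  | unpack (A' : Formula L) (m : L.Term ℕ) (t : PTerm L) (A : Formula L) (w : PTerm L) :
      Basic (.unpack (.pack A' m t) A w) ((w.instI m).inst t)
  | perm (A B : Formula L) (s t : PTerm L) (ξ : Frame L) :
      Basic ((PTerm.par A B s t).plug ξ) (.par A B (s.plug ξ.shift) (t.plug ξ.shift))

/-- `t[λ y^B w / a]`, moved to the hole of a parallel context that binds `k` variables below
the variable `a`: here `t` is directly in the scope of `a`, and `w` is in scope at the hole. -/
def send {L : FirstOrder.Language.{u, v}} (k : ℕ) (B : Formula L) (w t : PTerm L) : PTerm L :=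
  t.subst (scons (.lam B w.shift) (fun i => .var (i + (k + 1))))

/-- `ProcStep Γ p n p'`: the term `p` has a head redex, which starts in the elementary process
number `n` of `p` (counted from the left, beginning with `0`), and contracting it there
gives `p'`. -/
inductive ProcStep {L : FirstOrder.Language.{u, v}} (Γ : Ctx L) : PTerm L → ℕ → PTerm L → Prop
  | basic {r r' : PTerm L} (σ : Stack L) :
      Basic r r' → ProcStep Γ (r.plugs σ) 0 (r'.plugs σ)
  | abort (A B : Formula L) (t : PTerm L) (σ : Stack L) (T : Formula L) :
      HasType .LCstar Γ ((PTerm.app (.abort A B) t).plugs σ) T → HasType .LCstar Γ t T →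
      ProcStep Γ ((PTerm.app (.abort A B) t).plugs σ) 0 t
  | parLeft (A B : Formula L) (C : PCtx L) (w : PTerm L) (σ : Stack L) (t : PTerm L) :
      ProcStep Γ (.par A B (C.fill ((PTerm.app (.var C.depth) w).plugs σ)) t) C.before
        (.par A B (C.fill (send C.depth B w t)) t)
  | parRight (A B : Formula L) (C : PCtx L) (w : PTerm L) (σ : Stack L) (s : PTerm L) :
      ProcStep Γ (.par A B s (C.fill ((PTerm.app (.var C.depth) w).plugs σ)))
        (s.procs + C.before)
        (.par A B s (C.fill (send C.depth A w s)))

/-- Contraction of the head redex of some parallel process of `t`, the redex starting in the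
elementary process number `n` of `t`. -/
def StepAt {L : FirstOrder.Language.{u, v}} (Γ : Ctx L) (t : PTerm L) (n : ℕ) (t' : PTerm L) : Prop :=
  ∃ (D : PCtx L) (p p' : PTerm L) (k : ℕ),
    t = D.fill p ∧ ProcStep (D.ctx Γ) p k p' ∧ n = D.before + k ∧ t' = D.fill p'

/-- Head reduction `t ≻ t'`: contraction of the leftmost among the head redexes of the parallel
processes of `t`. -/
def HeadRed {L : FirstOrder.Language.{u, v}} (Γ : Ctx L) (t t' : PTerm L) : Prop :=
  ∃ n, StepAt Γ t n t' ∧ ∀ m < n, ∀ t'', ¬ StepAt Γ t m t''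

/-- `HN*`: the proof terms of `LC*` without infinite head reduction. -/
def HN {L : FirstOrder.Language.{u, v}} (Γ : Ctx L) (t : PTerm L) : Prop :=
  (∃ A, HasType .LCstar Γ t A) ∧
    ¬ ∃ f : ℕ → PTerm L, f 0 = t ∧ ∀ n, HeadRed Γ (f n) (f (n + 1))

/-- `σ` is adapted to the type `C`: for all `t : C` of `LC*`, also `t σ` is a proof term
of `LC*`. -/
def Adapted {L : FirstOrder.Language.{u, v}} (Γ : Ctx L) (C : Formula L) (σ : Stack L) : Prop :=
  ∀ t, HasType .LCstar Γ t C → ∃ D, HasType .LCstar Γ (t.plugs σ) D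

mutual

/-- `t ⊩ C`. Realizers may contain free variables; `Γ` gives the types of these. -/
def Realizes {L : FirstOrder.Language.{u, v}} (Γ : Ctx L) (t : PTerm L) (C : Formula L) : Prop :=
  HasType .LCstar Γ t C ∧ ∀ σ, IsTest Γ σ C → HN Γ (t.plugs σ)
termination_by (C.size, 1)

/-- `τ ∈ ‖C‖`: the stack `τ` is a valid test for `C`. -/
def IsTest {L : FirstOrder.Language.{u, v}} (Γ : Ctx L) (τ : Stack L) (C : Formula L) : Prop :=
  match C with
  | .bot => τ = []
  | .rel _ _ => τ = []
  | .imp A B => τ = [] ∨ ∃ s σ, τ = .app s :: σ ∧ Realizes Γ s A ∧ IsTest Γ σ B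
  | .and A B => τ = [] ∨ (∃ σ, τ = .fst :: σ ∧ IsTest Γ σ A) ∨ (∃ σ, τ = .snd :: σ ∧ IsTest Γ σ B)
  | .or A B => τ = [] ∨ ∃ w₁ w₂ σ, τ = .orElim A w₁ B w₂ :: σ ∧ Adapted Γ (.or A B) τ ∧
      ∀ t, (Realizes Γ t A → HN Γ ((w₁.inst t).plugs σ)) ∧
        (Realizes Γ t B → HN Γ ((w₂.inst t).plugs σ))
  | .all A => τ = [] ∨ ∃ (m : L.Term ℕ) (σ : Stack L), τ = .iapp m :: σ ∧ IsTest Γ σ (A.inst m)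
  | .ex A => τ = [] ∨ ∃ w σ, τ = .unpack A w :: σ ∧ Adapted Γ (.ex A) τ ∧
      ∀ (m : L.Term ℕ) (t : PTerm L), Realizes Γ t (A.inst m) →
        HN Γ (((w.instI m).inst t).plugs σ)
termination_by (C.size, 0)
decreasing_by all_goals simp [Formula.size, Formula.size_inst, Prod.lex_def]

end

end DummettLC

/-!
Adequacy is proved by induction on the typing derivation, for all substitutions and with the
context `Θ` of the realizers fixed. Apart from `∥`, every rule is immediate from the definition of
tests: an elimination extends the test by one frame, and an introduction, applied to a test, is a
redex whose contractum is head normalizing by the induction hypothesis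
(`IsTest.hn_plugs_of_contract`).

The case of `u ∥_a v`, of type `C`, is `realizes_par`. Applied to a test, the term permutes to
`U ∥_a V`, where `U` and `V` have a common type `D`, and head reduction, going leftmost first,
exhausts `U` before it touches `V`. While it works on `U`, it contracts head redexes of `U` and
replaces messages `a w ρ` by `V[λ y w / a]`. Both are simulated by head reduction of `U[T/a]`,
where `T = λ x^A 𝒜^{D → B} (V[λ y^B x / a])` (`channel`, `SideStep.transGen_headRed`): the message
has the type `D` of `V`, so that the abort constant fires. This `T` realizes `A → B`, because
`λ y w` realizes `B → A` whenever `w` realizes `A`; so `U[T/a]` is head normalizing, and the work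
on `U` ends with some `U'` that has no head redex and no message on `a`.

The same simulation then applies to `V` with `U'` in the place of `V`. Here the hypothesis of
`realizes_channel` asks that `U'[λ x w / a]` be head normalizing, which it is because no abstraction
substituted for `a` creates a head redex in `U'`. That head redexes of a substituted term come from
redexes and messages of the original one is `StepAt.of_subst`; it also ensures that the simulating
steps are leftmost. It relies on the uniqueness of types, by which an abort redex does not appear
through substitution.
-/

namespace DummettLC

variable {L : FirstOrder.Language}

open FirstOrder.Language (Term)

/-! ### Substitution calculus -/

theorem comp_scons {α β : Type*} (g : α → β) (x : α) (f : ℕ → α) :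
    (fun i => g (scons x f i)) = scons (g x) (fun i => g (f i)) := by
  funext i; cases i <;> rfl

theorem iterm_relabel_eq_subst (f : ℕ → ℕ) (m : L.Term ℕ) :
    m.relabel f = m.subst (fun n => Term.var (f n)) := by
  induction m with
  | var => rfl
  | func g ts ih => simp [Term.relabel, Term.subst, ih]

theorem iterm_subst_subst (ρ ρ' : ℕ → L.Term ℕ) (m : L.Term ℕ) :
    (m.subst ρ).subst ρ' = m.subst (fun n => (ρ n).subst ρ') := by
  induction m with
  | var => rfl
  | func g ts ih => simp [Term.subst, ih]

theorem iterm_subst_var (m : L.Term ℕ) : m.subst Term.var = m := by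
  induction m with
  | var => rfl
  | func g ts ih => simp [Term.subst, ih]

theorem upI_var : upI (L := L) Term.var = Term.var := by
  funext i; cases i <;> rfl

theorem upI_comp (ρ ρ' : ℕ → L.Term ℕ) :
    (fun n => (upI ρ n).subst (upI ρ')) = upI (fun n => (ρ n).subst ρ') := by
  funext i
  cases i with
  | zero => rfl
  | succ n =>
    simp [upI, scons, iterm_relabel_eq_subst, iterm_subst_subst, Term.subst]

namespace Formula

theorem subst_subst (A : Formula L) : ∀ ρ ρ' : ℕ → L.Term ℕ,
    (A.subst ρ).subst ρ' = A.subst (fun n => (ρ n).subst ρ') := by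
  induction A <;> intro ρ ρ' <;> simp_all [subst, iterm_subst_subst, upI_comp]

theorem subst_var (A : Formula L) : A.subst Term.var = A := by
  induction A <;> simp_all [subst, iterm_subst_var, upI_var]

theorem shift_subst_upI (A : Formula L) (ρ : ℕ → L.Term ℕ) :
    A.shift.subst (upI ρ) = (A.subst ρ).shift := by
  simp [shift, subst_subst, Term.subst, upI, scons, iterm_relabel_eq_subst]

theorem shift_subst_scons (A : Formula L) (m : L.Term ℕ) (ρ : ℕ → L.Term ℕ) :
    A.shift.subst (scons m ρ) = A.subst ρ := by
  simp [shift, subst_subst, Term.subst, scons]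

theorem shift_inst (A : Formula L) (m : L.Term ℕ) : A.shift.inst m = A := by
  rw [inst, shift_subst_scons, subst_var]

theorem subst_upI_inst (A : Formula L) (m : L.Term ℕ) (ρ : ℕ → L.Term ℕ) :
    (A.subst (upI ρ)).inst m = A.subst (scons m ρ) := by
  rw [inst, subst_subst]
  congr 1
  funext i
  cases i <;> simp [upI, scons, Term.subst, iterm_relabel_eq_subst, iterm_subst_subst,
    iterm_subst_var]

theorem inst_subst (A : Formula L) (m : L.Term ℕ) (ρ : ℕ → L.Term ℕ) :
    (A.inst m).subst ρ = (A.subst (upI ρ)).inst (m.subst ρ) := by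
  rw [subst_upI_inst, inst, subst_subst]
  congr 1
  funext i
  cases i <;> rfl

theorem shift_injective {A B : Formula L} (h : A.shift = B.shift) : A = B := by
  rw [← shift_inst A (Term.var 0), h, shift_inst]

end Formula

namespace PTerm

theorem substI_substI (t : PTerm L) : ∀ ρ ρ' : ℕ → L.Term ℕ,
    (t.substI ρ).substI ρ' = t.substI (fun n => (ρ n).subst ρ') := by
  induction t <;> intro ρ ρ' <;>
    simp_all [substI, iterm_subst_subst, Formula.subst_subst, upI_comp]

theorem substI_var (t : PTerm L) : t.substI Term.var = t := by
  induction t <;> simp_all [substI, iterm_subst_var, Formula.subst_var, upI_var]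

theorem shiftI_substI_upI (t : PTerm L) (ρ : ℕ → L.Term ℕ) :
    t.shiftI.substI (upI ρ) = (t.substI ρ).shiftI := by
  simp [shiftI, substI_substI, Term.subst, upI, scons, iterm_relabel_eq_subst]

theorem shiftI_substI_scons (t : PTerm L) (m : L.Term ℕ) (ρ : ℕ → L.Term ℕ) :
    t.shiftI.substI (scons m ρ) = t.substI ρ := by
  simp [shiftI, substI_substI, Term.subst, scons]

theorem shiftI_instI (t : PTerm L) (m : L.Term ℕ) : t.shiftI.instI m = t := by
  rw [instI, shiftI_substI_scons, substI_var]

theorem substI_upI_instI (t : PTerm L) (m : L.Term ℕ) (ρ : ℕ → L.Term ℕ) :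
    (t.substI (upI ρ)).instI m = t.substI (scons m ρ) := by
  rw [instI, substI_substI]
  congr 1
  funext i
  cases i <;> simp [upI, scons, Term.subst, iterm_relabel_eq_subst, iterm_subst_subst,
    iterm_subst_var]

theorem upRen_comp (ξ ζ : ℕ → ℕ) : (fun i => upRen ζ (upRen ξ i)) = upRen (fun i => ζ (ξ i)) := by
  funext i; cases i <;> rfl

theorem rename_rename (t : PTerm L) : ∀ ξ ζ : ℕ → ℕ,
    (t.rename ξ).rename ζ = t.rename (fun i => ζ (ξ i)) := by
  induction t <;> intro ξ ζ <;> simp_all [rename, upRen_comp]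

theorem rename_substI (t : PTerm L) : ∀ (ξ : ℕ → ℕ) (ρ : ℕ → L.Term ℕ),
    (t.rename ξ).substI ρ = (t.substI ρ).rename ξ := by
  induction t <;> intro ξ ρ <;> simp_all [rename, substI]

theorem shift_rename_upRen (t : PTerm L) (ξ : ℕ → ℕ) :
    t.shift.rename (upRen ξ) = (t.rename ξ).shift := by
  simp [shift, rename_rename, upRen, scons]

theorem shiftI_rename (t : PTerm L) (ξ : ℕ → ℕ) : (t.rename ξ).shiftI = t.shiftI.rename ξ :=
  rename_substI _ _ _

theorem upS_upRen (τ : ℕ → PTerm L) (ξ : ℕ → ℕ) :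
    (fun i => upS τ (upRen ξ i)) = upS (fun i => τ (ξ i)) := by
  funext i; cases i <;> rfl

theorem rename_subst (t : PTerm L) : ∀ (ξ : ℕ → ℕ) (τ : ℕ → PTerm L),
    (t.rename ξ).subst τ = t.subst (fun i => τ (ξ i)) := by
  induction t <;> intro ξ τ <;> simp_all [rename, subst, upS_upRen]

theorem upS_rename (τ : ℕ → PTerm L) (ξ : ℕ → ℕ) :
    (fun i => (upS τ i).rename (upRen ξ)) = upS (fun i => (τ i).rename ξ) := by
  funext i
  cases i with
  | zero => rfl
  | succ n => exact shift_rename_upRen _ _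

theorem subst_rename (t : PTerm L) : ∀ (τ : ℕ → PTerm L) (ξ : ℕ → ℕ),
    (t.subst τ).rename ξ = t.subst (fun i => (τ i).rename ξ) := by
  induction t <;> intro τ ξ <;> simp_all [rename, subst, upS_rename, shiftI_rename]

theorem upS_substI (τ : ℕ → PTerm L) (ρ : ℕ → L.Term ℕ) :
    (fun i => (upS τ i).substI ρ) = upS (fun i => (τ i).substI ρ) := by
  funext i
  cases i with
  | zero => rfl
  | succ n => exact rename_substI _ _ _

theorem subst_substI (t : PTerm L) : ∀ (τ : ℕ → PTerm L) (ρ : ℕ → L.Term ℕ),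
    (t.subst τ).substI ρ = (t.substI ρ).subst (fun i => (τ i).substI ρ) := by
  induction t <;> intro τ ρ <;> simp_all [substI, subst, upS_substI, shiftI_substI_upI]

theorem shift_subst_scons (t s : PTerm L) (τ : ℕ → PTerm L) :
    t.shift.subst (scons s τ) = t.subst τ := rename_subst _ _ _

theorem shift_subst_upS (t : PTerm L) (τ : ℕ → PTerm L) :
    t.shift.subst (upS τ) = (t.subst τ).shift := by
  rw [shift, rename_subst, shift, subst_rename]; rfl

theorem upS_comp (τ τ' : ℕ → PTerm L) :
    (fun i => (upS τ i).subst (upS τ')) = upS (fun i => (τ i).subst τ') := by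
  funext i
  cases i with
  | zero => rfl
  | succ n => exact shift_subst_upS _ _

theorem shiftI_subst (t : PTerm L) (τ : ℕ → PTerm L) :
    t.shiftI.subst (fun i => (τ i).shiftI) = (t.subst τ).shiftI :=
  (subst_substI _ _ _).symm

theorem subst_subst (t : PTerm L) : ∀ τ τ' : ℕ → PTerm L,
    (t.subst τ).subst τ' = t.subst (fun i => (τ i).subst τ') := by
  induction t <;> intro τ τ' <;> simp_all [subst, upS_comp, shiftI_subst]

theorem upS_var : upS (L := L) var = var := by
  funext i; cases i <;> rfl

theorem subst_var (t : PTerm L) : t.subst var = t := by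
  have h : (fun n => (var n : PTerm L).shiftI) = var := rfl
  induction t <;> simp_all [subst, upS_var]

theorem rename_eq_subst (t : PTerm L) (ξ : ℕ → ℕ) : t.rename ξ = t.subst (fun i => var (ξ i)) := by
  rw [← subst_var (t.rename ξ), rename_subst]

theorem shift_inst (t s : PTerm L) : t.shift.inst s = t := by
  rw [inst, shift_subst_scons, subst_var]

theorem subst_upS_inst (t s : PTerm L) (τ : ℕ → PTerm L) :
    (t.subst (upS τ)).inst s = t.subst (scons s τ) := by
  rw [inst, subst_subst]
  congr 1
  funext i
  cases i with
  | zero => rfl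
  | succ n => exact shift_inst _ _

theorem inst_subst (t s : PTerm L) (τ : ℕ → PTerm L) :
    (t.inst s).subst τ = (t.subst (upS τ)).inst (s.subst τ) := by
  rw [subst_upS_inst, inst, subst_subst, comp_scons]; rfl

theorem instI_subst (t : PTerm L) (m : L.Term ℕ) (τ : ℕ → PTerm L) :
    (t.instI m).subst τ = (t.subst (fun i => (τ i).shiftI)).instI m := by
  rw [instI, instI, subst_substI]
  congr 1
  funext i
  exact (shiftI_instI _ _).symm

theorem fv_substI (t : PTerm L) : ∀ ρ : ℕ → L.Term ℕ, (t.substI ρ).fv = t.fv := by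
  induction t <;> intro ρ <;> simp_all [substI, fv]

end PTerm

/-! ### Typing -/

theorem Formula.IsAtomic.subst {P : Formula L} (h : P.IsAtomic) (ρ : ℕ → L.Term ℕ) :
    (P.subst ρ).IsAtomic := by
  cases P <;> simp_all [Formula.IsAtomic, Formula.subst]

namespace HasType

variable {S : System} {Γ Δ : Ctx L} {t : PTerm L} {A B : Formula L}

theorem toLCstar (h : HasType .LC Γ t A) : HasType .LCstar Γ t A := by
  induction h with
  | abort Γ A B h => cases h
  | _ => constructor <;> assumption

theorem rename (h : HasType S Γ t A) : ∀ {Δ : Ctx L} (ξ : ℕ → ℕ), (∀ i, Δ (ξ i) = Γ i) →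
    HasType S Δ (t.rename ξ) A := by
  have up : ∀ {Γ Δ : Ctx L} {ξ : ℕ → ℕ} (A : Formula L), (∀ i, Δ (ξ i) = Γ i) →
      ∀ i, scons A Δ (PTerm.upRen ξ i) = scons A Γ i := by
    intro Γ Δ ξ A h i
    cases i with
    | zero => rfl
    | succ n => exact h n
  induction h with
  | var Γ i => intro Δ ξ hξ; rw [← hξ]; exact .var _ _
  | pair _ _ h1 h2 => intro Δ ξ hξ; exact .pair (h1 ξ hξ) (h2 ξ hξ)
  | fst _ h1 => intro Δ ξ hξ; exact .fst (h1 ξ hξ)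
  | snd _ h1 => intro Δ ξ hξ; exact .snd (h1 ξ hξ)
  | app _ _ h1 h2 => intro Δ ξ hξ; exact .app (h1 ξ hξ) (h2 ξ hξ)
  | lam _ h1 => intro Δ ξ hξ; exact .lam (h1 _ (up _ hξ))
  | inl _ h1 => intro Δ ξ hξ; exact .inl (h1 ξ hξ)
  | inr _ h1 => intro Δ ξ hξ; exact .inr (h1 ξ hξ)
  | orElim _ _ _ h1 h2 h3 =>
    intro Δ ξ hξ; exact .orElim (h1 ξ hξ) (h2 _ (up _ hξ)) (h3 _ (up _ hξ))
  | iapp m _ h1 => intro Δ ξ hξ; exact .iapp m (h1 ξ hξ)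
  | ilam _ h1 => intro Δ ξ hξ; exact .ilam (h1 ξ fun i => by rw [hξ])
  | pack m _ h1 => intro Δ ξ hξ; exact .pack m (h1 ξ hξ)
  | unpack _ _ h1 h2 =>
    intro Δ ξ hξ; exact .unpack (h1 ξ hξ) (h2 _ (up _ fun i => by rw [hξ]))
  | par _ _ h1 h2 => intro Δ ξ hξ; exact .par (h1 _ (up _ hξ)) (h2 _ (up _ hξ))
  | efq hP _ h1 => intro Δ ξ hξ; exact .efq hP (h1 ξ hξ)
  | abort Γ A B hS => intro Δ ξ hξ; exact .abort _ _ _ hS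

theorem shift (h : HasType S Γ t A) (X : Formula L) : HasType S (scons X Γ) t.shift A :=
  h.rename _ fun _ => rfl

theorem substI (h : HasType S Γ t A) : ∀ ρ : ℕ → L.Term ℕ,
    HasType S (fun i => (Γ i).subst ρ) (t.substI ρ) (A.subst ρ) := by
  induction h with
  | var Γ i => intro ρ; exact .var (fun i => (Γ i).subst ρ) i
  | pair _ _ h1 h2 => intro ρ; exact .pair (h1 ρ) (h2 ρ)
  | fst _ h1 => intro ρ; exact .fst (h1 ρ)
  | snd _ h1 => intro ρ; exact .snd (h1 ρ)
  | app _ _ h1 h2 => intro ρ; exact .app (h1 ρ) (h2 ρ)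
  | lam _ h1 =>
    intro ρ; refine .lam ?_
    have := h1 ρ
    rwa [comp_scons (fun A : Formula L => A.subst ρ)] at this
  | inl _ h1 => intro ρ; exact .inl (h1 ρ)
  | inr _ h1 => intro ρ; exact .inr (h1 ρ)
  | orElim _ _ _ h1 h2 h3 =>
    intro ρ
    have h2 := h2 ρ
    have h3 := h3 ρ
    rw [comp_scons (fun A : Formula L => A.subst ρ)] at h2 h3
    exact .orElim (h1 ρ) h2 h3
  | iapp m _ h1 => intro ρ; rw [Formula.inst_subst]; exact .iapp _ (h1 ρ)
  | ilam _ h1 =>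
    intro ρ; refine .ilam ?_
    have := h1 (upI ρ)
    simpa only [Formula.shift_subst_upI] using this
  | pack m _ h1 =>
    intro ρ; refine .pack _ ?_
    have := h1 ρ
    rwa [Formula.inst_subst] at this
  | unpack _ _ h1 h2 =>
    intro ρ; refine .unpack (h1 ρ) ?_
    have := h2 (upI ρ)
    rw [comp_scons (fun A : Formula L => A.subst (upI ρ))] at this
    simpa only [Formula.shift_subst_upI] using this
  | par _ _ h1 h2 =>
    intro ρ
    have h1 := h1 ρ
    have h2 := h2 ρ
    rw [comp_scons (fun A : Formula L => A.subst ρ)] at h1 h2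
    exact .par h1 h2
  | efq hP _ h1 => intro ρ; exact .efq (hP.subst ρ) (h1 ρ)
  | abort Γ A B hS => intro ρ; exact .abort _ _ _ hS

theorem shiftI (h : HasType S Γ t A) : HasType S (fun i => (Γ i).shift) t.shiftI A.shift :=
  h.substI _

theorem subst_of_fv (h : HasType S Γ t A) : ∀ {Δ : Ctx L} {τ : ℕ → PTerm L},
    (∀ i ∈ t.fv, HasType S Δ (τ i) (Γ i)) → HasType S Δ (t.subst τ) A := by
  have up : ∀ {Γ Δ : Ctx L} {τ : ℕ → PTerm L} {X : Formula L} {s : PTerm L},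
      (∀ i, i + 1 ∈ s.fv → HasType S Δ (τ i) (Γ i)) →
      ∀ i ∈ s.fv, HasType S (scons X Δ) (PTerm.upS τ i) (scons X Γ i) := by
    intro Γ Δ τ X s h i hi
    cases i with
    | zero => exact .var (scons X Δ) 0
    | succ n => exact (h n hi).shift X
  induction h with
  | var Γ i => intro Δ τ h; exact h i rfl
  | pair _ _ h1 h2 =>
    intro Δ τ h; exact .pair (h1 fun i hi => h i (.inl hi)) (h2 fun i hi => h i (.inr hi))
  | fst _ h1 => intro Δ τ h; exact .fst (h1 h)
  | snd _ h1 => intro Δ τ h; exact .snd (h1 h)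
  | app _ _ h1 h2 =>
    intro Δ τ h; exact .app (h1 fun i hi => h i (.inl hi)) (h2 fun i hi => h i (.inr hi))
  | lam _ h1 => intro Δ τ h; exact .lam (h1 (up h))
  | inl _ h1 => intro Δ τ h; exact .inl (h1 h)
  | inr _ h1 => intro Δ τ h; exact .inr (h1 h)
  | orElim _ _ _ h1 h2 h3 =>
    intro Δ τ h
    exact .orElim (h1 fun i hi => h i (.inl (.inl hi)))
      (h2 (up fun i hi => h i (.inl (.inr hi)))) (h3 (up fun i hi => h i (.inr hi)))
  | iapp m _ h1 => intro Δ τ h; exact .iapp m (h1 h)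
  | ilam _ h1 => intro Δ τ h; exact .ilam (h1 fun i hi => (h i hi).shiftI)
  | pack m _ h1 => intro Δ τ h; exact .pack m (h1 h)
  | unpack _ _ h1 h2 =>
    intro Δ τ h
    exact .unpack (h1 fun i hi => h i (.inl hi)) (h2 (up fun i hi => (h i (.inr hi)).shiftI))
  | par _ _ h1 h2 =>
    intro Δ τ h
    exact .par (h1 (up fun i hi => h i (.inl hi))) (h2 (up fun i hi => h i (.inr hi)))
  | efq hP _ h1 => intro Δ τ h; exact .efq hP (h1 h)
  | abort Γ A B hS => intro Δ τ h; exact .abort _ _ _ hS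

theorem subst (h : HasType S Γ t A) {τ : ℕ → PTerm L} (hτ : ∀ i, HasType S Δ (τ i) (Γ i)) :
    HasType S Δ (t.subst τ) A :=
  h.subst_of_fv fun i _ => hτ i

theorem inst {s : PTerm L} (h : HasType S (scons B Γ) t A) (hs : HasType S Γ s B) :
    HasType S Γ (t.inst s) A := by
  refine h.subst fun i => ?_
  cases i with
  | zero => exact hs
  | succ n => exact .var Γ n

theorem instI (h : HasType S Γ t A) (m : L.Term ℕ) :
    HasType S (fun i => (Γ i).inst m) (t.instI m) (A.inst m) :=
  h.substI _

theorem unique (h : HasType S Γ t A) : ∀ {B : Formula L}, HasType S Γ t B → A = B := by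
  induction h with
  | var => intro B h; cases h; rfl
  | pair _ _ h1 h2 => intro B h; cases h with | pair a b => rw [h1 a, h2 b]
  | fst _ h1 => intro B h; cases h with | fst a => cases h1 a; rfl
  | snd _ h1 => intro B h; cases h with | snd a => cases h1 a; rfl
  | app _ _ h1 h2 => intro B h; cases h with | app a b => cases h1 a; rfl
  | lam _ h1 => intro B h; cases h with | lam a => cases h1 a; rfl
  | inl _ h1 => intro B h; cases h with | inl a => cases h1 a; rfl
  | inr _ h1 => intro B h; cases h with | inr a => cases h1 a; rfl
  | orElim _ _ _ h1 h2 h3 => intro B h; cases h with | orElim a b c => exact h2 b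
  | iapp m _ h1 => intro B h; cases h with | iapp _ a => cases h1 a; rfl
  | ilam _ h1 => intro B h; cases h with | ilam a => cases h1 a; rfl
  | pack m _ h1 => intro B h; cases h with | pack _ a => rfl
  | unpack _ _ h1 h2 =>
    intro B h; cases h with | unpack a b => exact Formula.shift_injective (h2 b)
  | par _ _ h1 h2 => intro B h; cases h with | par a b => exact h1 a
  | efq hP _ h1 => intro B h; cases h; rfl
  | abort Γ A B hS => intro B h; cases h; rfl

end HasType

/-- A frame of type `C ⟶ D`: it turns proof terms of type `C` into proof terms of type `D`. -/
inductive FrameType (S : System) (Γ : Ctx L) : Frame L → Formula L → Formula L → Prop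
  | app {s : PTerm L} {A : Formula L} (B : Formula L) :
      HasType S Γ s A → FrameType S Γ (.app s) (.imp A B) B
  | iapp (m : L.Term ℕ) (A : Formula L) : FrameType S Γ (.iapp m) (.all A) (A.inst m)
  | fst (A B : Formula L) : FrameType S Γ .fst (.and A B) A
  | snd (A B : Formula L) : FrameType S Γ .snd (.and A B) B
  | orElim {w₁ w₂ : PTerm L} {A B C : Formula L} :
      HasType S (scons A Γ) w₁ C → HasType S (scons B Γ) w₂ C →
      FrameType S Γ (.orElim A w₁ B w₂) (.or A B) C
  | unpack {w : PTerm L} {A C : Formula L} :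
      HasType S (scons A (fun i => (Γ i).shift)) w C.shift → FrameType S Γ (.unpack A w) (.ex A) C

/-- A stack of type `C ⟶ D`. -/
inductive StackType (S : System) (Γ : Ctx L) : Stack L → Formula L → Formula L → Prop
  | nil (C : Formula L) : StackType S Γ [] C C
  | cons {ξ : Frame L} {σ : Stack L} {C D E : Formula L} :
      FrameType S Γ ξ C D → StackType S Γ σ D E → StackType S Γ (ξ :: σ) C E

variable {S : System} {Γ : Ctx L}

theorem hasType_plug {t : PTerm L} {ξ : Frame L} {D : Formula L} :
    HasType S Γ (t.plug ξ) D ↔ ∃ C, HasType S Γ t C ∧ FrameType S Γ ξ C D := by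
  constructor
  · intro h
    cases ξ <;> cases h <;> exact ⟨_, ‹_›, by constructor <;> assumption⟩
  · rintro ⟨C, h, h'⟩
    cases h' <;> constructor <;> assumption

theorem hasType_plugs {σ : Stack L} {D : Formula L} : ∀ {t : PTerm L},
    HasType S Γ (t.plugs σ) D ↔ ∃ C, HasType S Γ t C ∧ StackType S Γ σ C D := by
  induction σ with
  | nil =>
    intro t
    refine ⟨fun h => ⟨D, h, .nil D⟩, ?_⟩
    rintro ⟨C, h, ⟨⟩⟩
    exact h
  | cons ξ σ ih =>
    intro t
    refine (ih (t := t.plug ξ)).trans ⟨?_, ?_⟩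
    · rintro ⟨E, h, h'⟩
      obtain ⟨C, h1, h2⟩ := hasType_plug.1 h
      exact ⟨C, h1, .cons h2 h'⟩
    · rintro ⟨C, h, ⟨⟩⟩
      exact ⟨_, hasType_plug.2 ⟨C, h, ‹_›⟩, ‹_›⟩

theorem FrameType.shift {ξ : Frame L} {C D : Formula L} (h : FrameType S Γ ξ C D)
    (X : Formula L) : FrameType S (scons X Γ) ξ.shift C D := by
  have up : ∀ (Γ : Ctx L) (A X : Formula L) (i : ℕ),
      scons A (scons X Γ) (PTerm.upRen Nat.succ i) = scons A Γ i := by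
    intro Γ A X i; cases i <;> rfl
  cases h with
  | app _ h => exact .app _ (h.shift X)
  | iapp m _ => exact .iapp m _
  | fst _ _ => exact .fst _ _
  | snd _ _ => exact .snd _ _
  | orElim h1 h2 => exact .orElim (h1.rename _ (up _ _ _)) (h2.rename _ (up _ _ _))
  | unpack h =>
    refine .unpack (h.rename _ fun i => ?_)
    cases i <;> rfl

theorem StackType.shift {σ : Stack L} {C D : Formula L} (h : StackType S Γ σ C D)
    (X : Formula L) : StackType S (scons X Γ) (σ.map Frame.shift) C D := by
  induction h with
  | nil C => exact .nil C
  | cons h _ ih => exact .cons (h.shift X) ih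

/-! ### Substitution in frames and parallel contexts -/

open PTerm (upS)

/-- Simultaneous substitution of proof terms in a frame. -/
def Frame.subst (τ : ℕ → PTerm L) : Frame L → Frame L
  | .app s => .app (s.subst τ)
  | .iapp m => .iapp m
  | .fst => .fst
  | .snd => .snd
  | .orElim A w₁ B w₂ => .orElim A (w₁.subst (upS τ)) B (w₂.subst (upS τ))
  | .unpack A w => .unpack A (w.subst (upS (fun i => (τ i).shiftI)))

theorem PTerm.plug_subst (t : PTerm L) (ξ : Frame L) (τ : ℕ → PTerm L) :
    (t.plug ξ).subst τ = (t.subst τ).plug (ξ.subst τ) := by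
  cases ξ <;> rfl

theorem PTerm.plugs_subst (σ : Stack L) (τ : ℕ → PTerm L) : ∀ t : PTerm L,
    (t.plugs σ).subst τ = (t.subst τ).plugs (σ.map (Frame.subst τ)) := by
  induction σ with
  | nil => intro t; rfl
  | cons ξ σ ih => intro t; exact (ih (t.plug ξ)).trans (by rw [plug_subst]; rfl)

theorem Frame.shift_subst_upS (ξ : Frame L) (τ : ℕ → PTerm L) :
    ξ.shift.subst (upS τ) = (ξ.subst τ).shift := by
  cases ξ <;> simp [Frame.shift, Frame.subst, PTerm.shift_subst_upS, PTerm.rename_subst,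
    PTerm.subst_rename, PTerm.upS_upRen, PTerm.upS_rename]
  · exact ⟨rfl, rfl⟩
  · simp [upS, scons, PTerm.shiftI_rename, PTerm.shift]

theorem Frame.shift_subst_scons (ξ : Frame L) (s : PTerm L) (τ : ℕ → PTerm L) :
    ξ.shift.subst (scons s τ) = ξ.subst τ := by
  cases ξ <;> simp [Frame.shift, Frame.subst, PTerm.shift_subst_scons, PTerm.rename_subst,
    PTerm.upS_upRen, scons]

theorem Frame.subst_var (ξ : Frame L) : ξ.subst PTerm.var = ξ := by
  have h : (fun n => (PTerm.var n : PTerm L).shiftI) = PTerm.var := rfl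
  cases ξ <;> simp [Frame.subst, PTerm.subst_var, PTerm.upS_var, h]

theorem PTerm.plugs_shift_inst (U s : PTerm L) (σ : Stack L) :
    (U.plugs (σ.map Frame.shift)).inst s = (U.inst s).plugs σ := by
  rw [PTerm.inst, PTerm.plugs_subst, List.map_map]
  congr 1
  conv_rhs => rw [← List.map_id σ]
  congr 1
  funext ξ
  exact (Frame.shift_subst_scons ξ s _).trans (Frame.subst_var ξ)

/-- Lifting of a substitution under `k` binders for proof-term variables. -/
def upN : ℕ → (ℕ → PTerm L) → ℕ → PTerm L
  | 0, τ => τ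
  | k + 1, τ => upN k (upS τ)

theorem upN_add (k : ℕ) : ∀ (τ : ℕ → PTerm L) (i : ℕ),
    upN k τ (i + k) = (τ i).rename (· + k) := by
  induction k with
  | zero =>
    intro τ i
    rw [PTerm.rename_eq_subst]
    exact (PTerm.subst_var _).symm
  | succ k ih =>
    intro τ i
    have := ih (upS τ) (i + 1)
    rw [upN, show i + (k + 1) = i + 1 + k by omega, this]
    change (τ i).shift.rename _ = _
    rw [PTerm.shift, PTerm.rename_rename]
    congr 1
    funext j
    omega

theorem upN_upS_self (k : ℕ) (τ : ℕ → PTerm L) : upN k (upS τ) k = .var k := by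
  have := upN_add k (upS τ) 0
  rw [Nat.zero_add] at this
  rw [this]
  simp [upS, scons, PTerm.rename]

namespace PCtx

/-- Simultaneous substitution of proof terms in a parallel context. -/
def subst : (ℕ → PTerm L) → PCtx L → PCtx L
  | _, hole => hole
  | τ, left A B C t => left A B (C.subst (upS τ)) (t.subst (upS τ))
  | τ, right A B s C => right A B (s.subst (upS τ)) (C.subst (upS τ))

theorem fill_subst (C : PCtx L) (p : PTerm L) : ∀ τ : ℕ → PTerm L,
    (C.fill p).subst τ = (C.subst τ).fill (p.subst (upN C.depth τ)) := by
  induction C <;> intro τ <;> simp_all [fill, PTerm.subst, subst, upN, depth]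

theorem depth_subst (C : PCtx L) : ∀ τ : ℕ → PTerm L, (C.subst τ).depth = C.depth := by
  induction C <;> intro τ <;> simp_all [subst, depth]

theorem ctx_add (C : PCtx L) : ∀ (Γ : Ctx L) (i : ℕ), C.ctx Γ (i + C.depth) = Γ i := by
  induction C with
  | hole => intro Γ i; rfl
  | left A B C t ih =>
    intro Γ i; rw [ctx, depth, show i + (C.depth + 1) = i + 1 + C.depth by omega, ih]; rfl
  | right A B s C ih =>
    intro Γ i; rw [ctx, depth, show i + (C.depth + 1) = i + 1 + C.depth by omega, ih]; rfl

theorem ctx_depth (C : PCtx L) (Γ : Ctx L) : C.ctx Γ C.depth = Γ 0 := by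
  simpa using C.ctx_add Γ 0

theorem hasType_fill {S : System} (C : PCtx L) {A : Formula L} : ∀ {Γ : Ctx L} {p p' : PTerm L},
    HasType S Γ (C.fill p) A → HasType S (C.ctx Γ) p' A → HasType S Γ (C.fill p') A := by
  induction C with
  | hole => intro Γ p p' _ h; exact h
  | left A B C t ih => intro Γ p p' h h'; cases h with | par h1 h2 => exact .par (ih h1 h') h2
  | right A B s C ih => intro Γ p p' h h'; cases h with | par h1 h2 => exact .par h1 (ih h2 h')

theorem hasType_of_fill {S : System} (C : PCtx L) {A : Formula L} : ∀ {Γ : Ctx L} {p : PTerm L},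
    HasType S Γ (C.fill p) A → HasType S (C.ctx Γ) p A := by
  induction C with
  | hole => intro Γ p h; exact h
  | left A B C t ih => intro Γ p h; cases h with | par h1 h2 => exact ih h1
  | right A B s C ih => intro Γ p h; cases h with | par h1 h2 => exact ih h2

end PCtx

theorem send_subst (k : ℕ) (B : Formula L) (w t : PTerm L) (τ : ℕ → PTerm L) :
    (send k B w t).subst (upN k (upS τ)) =
      send k B (w.subst (upN k (upS τ))) (t.subst (upS τ)) := by
  rw [send, send, PTerm.subst_subst, PTerm.subst_subst]
  congr 1
  funext i
  cases i with
  | zero => simp [scons, PTerm.subst, upS]; exact PTerm.shift_subst_upS _ _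
  | succ i =>
    have := upN_add k (upS τ) (i + 1)
    change upN k (upS τ) (i + (k + 1)) = (τ i).shift.subst _
    rw [show i + (k + 1) = i + 1 + k by omega, this, PTerm.shift_subst_scons,
      ← PTerm.rename_eq_subst]
    change (τ i).shift.rename _ = _
    rw [PTerm.shift, PTerm.rename_rename]
    congr 1
    funext j
    omega

/-! ### Heads of proof terms -/

namespace PTerm

/-- A term that is not an elimination, so that it is the head of its applications to stacks. -/
def IsHead : PTerm L → Prop
  | fst _ | snd _ | app _ _ | orElim _ _ _ _ _ | iapp _ _ | unpack _ _ _ => False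
  | _ => True

/-- A term that is not of the form `s ∥_a t`. -/
def IsElementary : PTerm L → Prop
  | par _ _ _ _ => False
  | _ => True

theorem not_isHead_plug (t : PTerm L) (ξ : Frame L) : ¬ (t.plug ξ).IsHead := by
  cases ξ <;> exact id

theorem isElementary_plug (t : PTerm L) (ξ : Frame L) : (t.plug ξ).IsElementary := by
  cases ξ <;> trivial

theorem plugs_append (t : PTerm L) (σ σ' : Stack L) :
    t.plugs (σ ++ σ') = (t.plugs σ).plugs σ' := List.foldl_append

theorem IsElementary.plugs {t : PTerm L} (h : t.IsElementary) (σ : Stack L) :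
    (t.plugs σ).IsElementary := by
  rcases List.eq_nil_or_concat σ with rfl | ⟨σ', ξ, rfl⟩
  · exact h
  · rw [List.concat_eq_append, plugs_append]; exact isElementary_plug _ _

theorem plug_inj {t t' : PTerm L} {ξ ξ' : Frame L} (h : t.plug ξ = t'.plug ξ') :
    t = t' ∧ ξ = ξ' := by
  cases ξ <;> cases ξ' <;> simp_all [plug]

theorem exists_head (t : PTerm L) : ∃ (h : PTerm L) (σ : Stack L), h.IsHead ∧ t = h.plugs σ := by
  have key : ∀ (s : PTerm L) (ξ : Frame L), (∃ (h : PTerm L) (σ : Stack L), h.IsHead ∧ s = h.plugs σ) →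
      ∃ (h : PTerm L) (σ : Stack L), h.IsHead ∧ s.plug ξ = h.plugs σ := by
    rintro s ξ ⟨h, σ, hh, rfl⟩
    exact ⟨h, σ ++ [ξ], hh, by rw [plugs_append]; rfl⟩
  have head : ∀ s : PTerm L, s.IsHead → ∃ (h : PTerm L) (σ : Stack L), h.IsHead ∧ s = h.plugs σ :=
    fun s hs => ⟨s, [], hs, rfl⟩
  induction t with
  | fst t ih => exact key t .fst ih
  | snd t ih => exact key t .snd ih
  | app t s ih _ => exact key t (.app s) ih
  | orElim t A w₁ B w₂ ih _ _ => exact key t (.orElim A w₁ B w₂) ih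
  | iapp t m ih => exact key t (.iapp m) ih
  | unpack t A w ih _ => exact key t (.unpack A w) ih
  | _ => exact head _ trivial

/-- The decomposition of a proof term into a head and a stack is unique; therefore an elementary
process has at most one head redex, and its contractum is determined. -/
theorem head_unique {h h' : PTerm L} (hh : h.IsHead) (hh' : h'.IsHead) (σ : Stack L) :
    ∀ σ' : Stack L, h.plugs σ = h'.plugs σ' → h = h' ∧ σ = σ' := by
  induction σ using List.reverseRecOn with
  | nil =>
    intro σ' e
    rcases List.eq_nil_or_concat σ' with rfl | ⟨σ', ξ, rfl⟩
    · exact ⟨e, rfl⟩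
    · rw [List.concat_eq_append, plugs_append] at e
      change h = (h'.plugs σ').plug ξ at e
      exact absurd (e ▸ hh) (not_isHead_plug _ _)
  | append_singleton σ ξ ih =>
    intro σ' e
    rcases List.eq_nil_or_concat σ' with rfl | ⟨σ', ξ', rfl⟩
    · rw [plugs_append] at e
      change (h.plugs σ).plug ξ = h' at e
      exact absurd (e ▸ hh') (not_isHead_plug _ _)
    · rw [List.concat_eq_append, plugs_append, plugs_append] at e
      obtain ⟨e1, e2⟩ := plug_inj e
      obtain ⟨rfl, rfl⟩ := ih _ e1
      exact ⟨rfl, by rw [e2, List.concat_eq_append]⟩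

/-- Induction along the tree of parallel processes. -/
theorem processInduction {P : PTerm L → Prop} (elem : ∀ t : PTerm L, t.IsElementary → P t)
    (par : ∀ A B s t, P s → P t → P (.par A B s t)) (t : PTerm L) : P t := by
  induction t with
  | par A B s t hs ht => exact par A B s t hs ht
  | _ => exact elem _ trivial

theorem IsElementary.procs {t : PTerm L} (h : t.IsElementary) : t.procs = 1 := by
  cases t <;> first | rfl | exact h.elim

theorem procs_pos (t : PTerm L) : 0 < t.procs := by
  induction t using processInduction with
  | elem t h => rw [h.procs]; exact Nat.one_pos
  | par A B s t hs ht => rw [PTerm.procs]; omega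

end PTerm

theorem PCtx.eq_hole_of_isElementary {C : PCtx L} {p : PTerm L} (h : (C.fill p).IsElementary) :
    C = .hole := by
  cases C <;> first | rfl | exact h.elim

theorem PCtx.before_lt_procs (C : PCtx L) (p : PTerm L) : C.before < (C.fill p).procs := by
  induction C with
  | hole => exact p.procs_pos
  | left A B C t ih => exact Nat.lt_add_right _ ih
  | right A B s C ih => exact Nat.add_lt_add_left ih _

/-! ### Head reduction -/

/-- The result of contracting the redex formed by the head `h` and the frame `ξ`, if they form
one by the rules of `Basic`. -/
def contract : PTerm L → Frame L → Option (PTerm L)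
  | .par A B s t, ξ => some (.par A B (s.plug ξ.shift) (t.plug ξ.shift))
  | .lam _ t, .app s => some (t.inst s)
  | .ilam t, .iapp m => some (t.instI m)
  | .pair s _, .fst => some s
  | .pair _ t, .snd => some t
  | .inl _ t, .orElim _ w₁ _ _ => some (w₁.inst t)
  | .inr _ t, .orElim _ _ _ w₂ => some (w₂.inst t)
  | .pack _ m t, .unpack _ w => some ((w.instI m).inst t)
  | _, _ => none

theorem basic_iff_contract {r r' : PTerm L} :
    Basic r r' ↔ ∃ h ξ, r = h.plug ξ ∧ contract h ξ = some r' := by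
  constructor
  · intro h
    cases h with
    | beta A t s => exact ⟨.lam A t, .app s, rfl, rfl⟩
    | betaI t m => exact ⟨.ilam t, .iapp m, rfl, rfl⟩
    | fst => exact ⟨.pair r' _, .fst, rfl, rfl⟩
    | snd => exact ⟨.pair _ r', .snd, rfl, rfl⟩
    | inl B' t A w₁ B w₂ => exact ⟨.inl B' t, .orElim A w₁ B w₂, rfl, rfl⟩
    | inr B' t A w₁ B w₂ => exact ⟨.inr B' t, .orElim A w₁ B w₂, rfl, rfl⟩
    | unpack A' m t A w => exact ⟨.pack A' m t, .unpack A w, rfl, rfl⟩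
    | perm A B s t ξ => exact ⟨.par A B s t, ξ, rfl, by cases ξ <;> rfl⟩
  · rintro ⟨h, ξ, rfl, e⟩
    cases h with
    | par A B s t =>
      cases ξ <;> (simp only [contract, Option.some.injEq] at e; subst e; exact .perm A B s t _)
    | _ =>
      cases ξ <;> simp only [contract, Option.some.injEq, reduceCtorEq] at e <;> subst e <;>
        constructor

theorem isHead_of_contract {h r : PTerm L} {ξ : Frame L} (e : contract h ξ = some r) :
    h.IsHead := by
  cases h <;> trivial

/-- At a head other than a variable, substitution neither creates nor destroys a redex. -/
theorem contract_subst {h : PTerm L} (hv : ∀ i, h ≠ .var i) (hh : h.IsHead) (ξ : Frame L)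
    (τ : ℕ → PTerm L) :
    contract (h.subst τ) (ξ.subst τ) = (contract h ξ).map (PTerm.subst τ) := by
  have hup : (fun i => (upS τ i).shiftI) = upS fun i => (τ i).shiftI := PTerm.upS_substI τ _
  cases h with
  | var i => exact absurd rfl (hv i)
  | par A B s t =>
    cases ξ <;> simp [contract, PTerm.subst, PTerm.plug_subst, ← Frame.shift_subst_upS]
  | _ =>
    cases ξ <;> first
      | exact hh.elim
      | simp [contract, PTerm.subst, Frame.subst, PTerm.inst_subst, PTerm.instI_subst, hup]

/-- The steps of elementary processes. -/
theorem stepAt_elementary {Γ : Ctx L} {X Z : PTerm L} {n : ℕ} (hX : X.IsElementary) :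
    StepAt Γ X n Z ↔ n = 0 ∧
      ((∃ h ξ σ r, X = h.plugs (ξ :: σ) ∧ contract h ξ = some r ∧ Z = r.plugs σ) ∨
      (∃ A B t σ T, X = (PTerm.abort A B).plugs (.app t :: σ) ∧ HasType .LCstar Γ X T ∧
        HasType .LCstar Γ t T ∧ Z = t)) := by
  constructor
  · rintro ⟨D, p, p', k, rfl, hp, rfl, rfl⟩
    obtain rfl := PCtx.eq_hole_of_isElementary hX
    cases hp with
    | basic σ hb =>
      obtain ⟨h, ξ, rfl, e⟩ := basic_iff_contract.1 hb
      exact ⟨rfl, .inl ⟨h, ξ, σ, _, rfl, e, rfl⟩⟩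
    | abort A B t σ T h1 h2 => exact ⟨rfl, .inr ⟨A, B, _, σ, T, rfl, h1, h2, rfl⟩⟩
    | parLeft => exact hX.elim
    | parRight => exact hX.elim
  · rintro ⟨rfl, ⟨h, ξ, σ, r, rfl, e, rfl⟩ | ⟨A, B, t, σ, T, rfl, h1, h2, rfl⟩⟩
    · exact ⟨.hole, _, _, 0, rfl, .basic σ (basic_iff_contract.2 ⟨h, ξ, rfl, e⟩), rfl, rfl⟩
    · exact ⟨.hole, _, _, 0, rfl, .abort A B _ σ T h1 h2, rfl, rfl⟩

/-- `X` has a message `a w ρ`, where `a` is the variable `0`, in its elementary process number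
`n`, and replacing the message by `Y[λ y^B w / a]` gives `X'`. -/
def CommAt (B : Formula L) (Y X : PTerm L) (n : ℕ) (X' : PTerm L) : Prop :=
  ∃ (C : PCtx L) (w : PTerm L) (σ : Stack L),
    X = C.fill ((PTerm.app (.var C.depth) w).plugs σ) ∧ n = C.before ∧
      X' = C.fill (send C.depth B w Y)

/-- The elementary process number `n` of `X` is of the form `a w ρ`, where `a` is the variable
that has index `i` outside `X`. -/
def HasMessage (X : PTerm L) (n i : ℕ) : Prop :=
  ∃ (C : PCtx L) (w : PTerm L) (σ : Stack L),
    X = C.fill ((PTerm.app (.var (i + C.depth)) w).plugs σ) ∧ n = C.before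

/-- The steps that the component `X` of `X ∥_a Y` (or of `Y ∥_a X`) makes: its own, and the
reception of `Y` through the channel `a`. The context `Γ` includes `a`. -/
def SideStep (Γ : Ctx L) (B : Formula L) (Y X : PTerm L) (n : ℕ) (X' : PTerm L) : Prop :=
  StepAt Γ X n X' ∨ CommAt B Y X n X'

theorem HasMessage.commAt {X : PTerm L} {n : ℕ} (h : HasMessage X n 0) (B : Formula L)
    (Y : PTerm L) : ∃ X', CommAt B Y X n X' := by
  obtain ⟨C, w, σ, rfl, rfl⟩ := h
  exact ⟨_, C, w, σ, by rw [Nat.zero_add], rfl, rfl⟩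

theorem CommAt.hasMessage {B : Formula L} {Y X X' : PTerm L} {n : ℕ} (h : CommAt B Y X n X') :
    HasMessage X n 0 := by
  obtain ⟨C, w, σ, rfl, rfl, rfl⟩ := h
  exact ⟨C, w, σ, by rw [Nat.zero_add], rfl⟩

/-- The steps of `s ∥_a t` are those of its two components, where a communication through `a` is
attributed to the component that contains the message. -/
theorem stepAt_par {Γ : Ctx L} {A B : Formula L} {s t Z : PTerm L} {n : ℕ} :
    StepAt Γ (.par A B s t) n Z ↔
      (∃ s', SideStep (scons (.imp A B) Γ) B t s n s' ∧ Z = .par A B s' t) ∨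
      (∃ t' k, SideStep (scons (.imp B A) Γ) A s t k t' ∧ n = s.procs + k ∧
        Z = .par A B s t') := by
  constructor
  · rintro ⟨D, p, p', k, e, hp, rfl, rfl⟩
    cases D with
    | hole =>
      change _ = p at e
      subst e
      generalize hq : PTerm.par A B s t = q at hp
      cases hp with
      | @basic r _ σ hb =>
        obtain ⟨h, ξ, rfl, -⟩ := basic_iff_contract.1 hb
        have := (PTerm.isElementary_plug h ξ).plugs σ
        rw [← hq] at this
        exact this.elim
      | abort A' B' t' σ T h1 h2 =>
        have := PTerm.IsElementary.plugs (t := .app (.abort A' B') p') trivial σ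
        rw [← hq] at this
        exact this.elim
      | parLeft A B C w σ t =>
        cases hq
        exact .inl ⟨_, .inr ⟨C, w, σ, rfl, by simp [PCtx.before], rfl⟩, rfl⟩
      | parRight A B C w σ s =>
        cases hq
        exact .inr ⟨_, _, .inr ⟨C, w, σ, rfl, rfl, rfl⟩, by simp [PCtx.before], rfl⟩
    | left A B C t => cases e; exact .inl ⟨_, .inl ⟨C, p, p', k, rfl, hp, rfl, rfl⟩, rfl⟩
    | right A B s C =>
      cases e
      exact .inr ⟨_, _, .inl ⟨C, p, p', k, rfl, hp, rfl, rfl⟩, Nat.add_assoc _ _ _, rfl⟩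
  · rintro (⟨s', h | h, rfl⟩ | ⟨t', k, h | h, rfl, rfl⟩)
    · obtain ⟨D, p, p', k, rfl, hp, rfl, rfl⟩ := h
      exact ⟨.left A B D t, p, p', k, rfl, hp, rfl, rfl⟩
    · obtain ⟨C, w, σ, rfl, rfl, rfl⟩ := h
      exact ⟨.hole, _, _, _, rfl, .parLeft A B C w σ t, (Nat.zero_add _).symm, rfl⟩
    · obtain ⟨D, p, p', k, rfl, hp, rfl, rfl⟩ := h
      exact ⟨.right A B s D, p, p', k, rfl, hp, (Nat.add_assoc _ _ _).symm, rfl⟩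
    · obtain ⟨C, w, σ, rfl, rfl, rfl⟩ := h
      exact ⟨.hole, _, _, _, rfl, .parRight A B C w σ s, (Nat.zero_add _).symm, rfl⟩

theorem hasMessage_par {A B : Formula L} {s t : PTerm L} {n i : ℕ} :
    HasMessage (.par A B s t) n i ↔
      HasMessage s n (i + 1) ∨ ∃ k, HasMessage t k (i + 1) ∧ n = s.procs + k := by
  have succ : ∀ d, i + (d + 1) = i + 1 + d := by intro d; omega
  constructor
  · rintro ⟨C, w, σ, e, rfl⟩
    cases C with
    | hole =>
      have := PTerm.IsElementary.plugs (t := .app (.var (i + 0)) w) trivial σ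
      change _ = (PTerm.app (.var (i + 0)) w).plugs σ at e
      rw [← e] at this
      exact this.elim
    | left A B C t => cases e; exact .inl ⟨C, w, σ, by rw [PCtx.depth, succ], rfl⟩
    | right A B s C => cases e; exact .inr ⟨_, ⟨C, w, σ, by rw [PCtx.depth, succ], rfl⟩, rfl⟩
  · rintro (⟨C, w, σ, rfl, rfl⟩ | ⟨k, ⟨C, w, σ, rfl, rfl⟩, rfl⟩)
    · exact ⟨.left A B C t, w, σ, by rw [PCtx.depth, PCtx.fill, ← succ], rfl⟩
    · exact ⟨.right A B s C, w, σ, by rw [PCtx.depth, PCtx.fill, ← succ], rfl⟩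

theorem hasMessage_elementary {X : PTerm L} {n i : ℕ} (hX : X.IsElementary) :
    HasMessage X n i ↔ n = 0 ∧ ∃ w σ, X = (PTerm.var i).plugs (.app w :: σ) := by
  constructor
  · rintro ⟨C, w, σ, rfl, rfl⟩
    obtain rfl := PCtx.eq_hole_of_isElementary hX
    exact ⟨rfl, w, σ, rfl⟩
  · rintro ⟨rfl, w, σ, rfl⟩
    exact ⟨.hole, w, σ, rfl, rfl⟩

theorem HasMessage.lt_procs {X : PTerm L} {n i : ℕ} (h : HasMessage X n i) : n < X.procs := by
  obtain ⟨C, w, σ, rfl, rfl⟩ := h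
  exact C.before_lt_procs _

theorem StepAt.lt_procs {X : PTerm L} : ∀ {Γ : Ctx L} {X' : PTerm L} {n : ℕ},
    StepAt Γ X n X' → n < X.procs := by
  induction X using PTerm.processInduction with
  | elem X hX =>
    intro Γ X' n h
    rw [((stepAt_elementary hX).1 h).1]
    exact X.procs_pos
  | par A B s t hs ht =>
    intro Γ X' n h
    rw [PTerm.procs]
    rcases stepAt_par.1 h with ⟨s', h1 | h1, -⟩ | ⟨t', k, h1 | h1, rfl, -⟩
    · exact Nat.lt_add_right _ (hs h1)
    · exact Nat.lt_add_right _ h1.hasMessage.lt_procs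
    · exact Nat.add_lt_add_left (ht h1) _
    · exact Nat.add_lt_add_left h1.hasMessage.lt_procs _

theorem SideStep.lt_procs {Γ : Ctx L} {B : Formula L} {Y X X' : PTerm L} {n : ℕ}
    (h : SideStep Γ B Y X n X') : n < X.procs :=
  h.elim StepAt.lt_procs fun h => h.hasMessage.lt_procs

/-! ### Subject reduction -/

theorem Basic.hasType {S : System} {Γ : Ctx L} {r r' : PTerm L} {A : Formula L}
    (h : Basic r r') (hr : HasType S Γ r A) : HasType S Γ r' A := by
  have inst_shift : ∀ m : L.Term ℕ, (fun i => (Γ i).shift.inst m) = Γ := fun m =>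
    funext fun i => (Γ i).shift_inst m
  cases h with
  | beta => cases hr with | app h1 h2 => cases h1 with | lam h1 => exact h1.inst h2
  | betaI =>
    cases hr with | iapp _ h1 => cases h1 with | ilam h1 =>
      have := h1.instI ‹_›
      rwa [inst_shift] at this
  | fst => cases hr with | fst h => cases h with | pair h1 h2 => exact h1
  | snd => cases hr with | snd h => cases h with | pair h1 h2 => exact h2
  | inl => cases hr with | orElim h h1 h2 => cases h with | inl h => exact h1.inst h
  | inr => cases hr with | orElim h h1 h2 => cases h with | inr h => exact h2.inst h
  | unpack =>
    cases hr with | unpack h h1 => cases h with | pack _ h =>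
      have := h1.instI ‹_›
      rw [Formula.shift_inst, comp_scons (fun A : Formula L => A.inst _), inst_shift] at this
      exact this.inst h
  | perm A B s t ξ =>
    obtain ⟨C, h, hξ⟩ := hasType_plug.1 hr
    cases h with
    | par h1 h2 =>
      exact .par (hasType_plug.2 ⟨C, h1, hξ.shift _⟩) (hasType_plug.2 ⟨C, h2, hξ.shift _⟩)

theorem hasType_send {Γ : Ctx L} {A B T : Formula L} {Y : PTerm L} (C : PCtx L)
    (hY : HasType .LCstar (scons (.imp B A) Γ) Y T) {w : PTerm L}
    (hw : HasType .LCstar (C.ctx (scons (.imp A B) Γ)) w A) :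
    HasType .LCstar (C.ctx (scons (.imp A B) Γ)) (send C.depth B w Y) T := by
  refine hY.subst fun i => ?_
  cases i with
  | zero => exact .lam (hw.shift B)
  | succ i =>
    have := C.ctx_add (scons (.imp A B) Γ) (i + 1)
    change HasType _ _ (.var (i + (C.depth + 1))) (Γ i)
    rw [show i + (C.depth + 1) = i + 1 + C.depth by omega]
    change _ = Γ i at this
    rw [← this]
    exact .var _ _

theorem hasType_var {S : System} {Γ : Ctx L} {i : ℕ} {A : Formula L}
    (h : HasType S Γ (.var i) A) : A = Γ i := by
  cases h; rfl

theorem CommAt.hasType {Γ : Ctx L} {A B T : Formula L} {X X' Y : PTerm L} {n : ℕ}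
    (hY : HasType .LCstar (scons (.imp B A) Γ) Y T) (h : CommAt B Y X n X')
    (hX : HasType .LCstar (scons (.imp A B) Γ) X T) :
    HasType .LCstar (scons (.imp A B) Γ) X' T := by
  obtain ⟨C, w, σ, rfl, rfl, rfl⟩ := h
  refine C.hasType_fill hX (hasType_send C hY ?_)
  obtain ⟨D, h, -⟩ := hasType_plugs.1 (C.hasType_of_fill hX)
  cases h with
  | app h1 h2 =>
    have hE := hasType_var h1
    rw [C.ctx_depth] at hE
    cases hE
    exact h2

theorem StepAt.hasType {X : PTerm L} : ∀ {Γ : Ctx L} {X' : PTerm L} {n : ℕ} {A : Formula L},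
    StepAt Γ X n X' → HasType .LCstar Γ X A → HasType .LCstar Γ X' A := by
  induction X using PTerm.processInduction with
  | elem X hX =>
    intro Γ X' n A hs hA
    obtain ⟨-, ⟨h, ξ, σ, r, rfl, e, rfl⟩ | ⟨_, _, t, σ, T, rfl, h1, h2, rfl⟩⟩ :=
      (stepAt_elementary hX).1 hs
    · obtain ⟨C, h1, h2⟩ := hasType_plugs.1 (show HasType _ _ ((h.plug ξ).plugs σ) _ from hA)
      exact hasType_plugs.2 ⟨C, (basic_iff_contract.2 ⟨h, ξ, rfl, e⟩).hasType h1, h2⟩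
    · rwa [hA.unique h1]
  | par A B s t hs ht =>
    intro Γ X' n T h hT
    cases hT with
    | par h1 h2 =>
      rcases stepAt_par.1 h with ⟨s', h' | h', rfl⟩ | ⟨t', k, h' | h', rfl, rfl⟩
      · exact .par (hs h' h1) h2
      · exact .par (h'.hasType h2 h1) h2
      · exact .par h1 (ht h' h2)
      · exact .par h1 (h'.hasType h1 h2)

theorem SideStep.hasType {Γ : Ctx L} {A B T : Formula L} {X X' Y : PTerm L} {n : ℕ}
    (h : SideStep (scons (.imp A B) Γ) B Y X n X')
    (hY : HasType .LCstar (scons (.imp B A) Γ) Y T)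
    (hX : HasType .LCstar (scons (.imp A B) Γ) X T) :
    HasType .LCstar (scons (.imp A B) Γ) X' T :=
  h.elim (fun h => StepAt.hasType h hX) fun h => h.hasType hY hX

/-! ### Head reduction under substitution -/

/-- A substitution whose values are variables and abstractions `λ x^A t`. Such a substitution
creates head redexes only where it hits the head of a message. -/
def ChannelSubst (τ : ℕ → PTerm L) : Prop :=
  ∀ i, (∃ j, τ i = .var j) ∨ ∃ A t, τ i = .lam A t

theorem ChannelSubst.upS {τ : ℕ → PTerm L} (h : ChannelSubst τ) : ChannelSubst (upS τ) := by
  intro i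
  cases i with
  | zero => exact .inl ⟨0, rfl⟩
  | succ i =>
    rcases h i with ⟨j, e⟩ | ⟨A, t, e⟩
    · exact .inl ⟨j + 1, by simp [PTerm.upS, scons, e, PTerm.shift, PTerm.rename]⟩
    · exact .inr ⟨A, _, by simp only [PTerm.upS, scons, e, PTerm.shift, PTerm.rename]; rfl⟩

theorem channelSubst_scons_lam (A : Formula L) (t : PTerm L) :
    ChannelSubst (scons (.lam A t) PTerm.var) := by
  intro i
  cases i with
  | zero => exact .inr ⟨A, t, rfl⟩
  | succ i => exact .inl ⟨i, rfl⟩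

theorem hasType_upS {Γ Δ : Ctx L} {τ : ℕ → PTerm L} (X : Formula L)
    (h : ∀ i, HasType .LCstar Δ (τ i) (Γ i)) (i : ℕ) :
    HasType .LCstar (scons X Δ) (upS τ i) (scons X Γ i) := by
  cases i with
  | zero => exact .var (scons X Δ) 0
  | succ i => exact (h i).shift X

theorem isHead_subst {τ : ℕ → PTerm L} (hτ : ChannelSubst τ) {h : PTerm L} (hh : h.IsHead) :
    (h.subst τ).IsHead := by
  cases h with
  | var i =>
    rcases hτ i with ⟨j, e⟩ | ⟨A, t, e⟩ <;> rw [PTerm.subst, e] <;> trivial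
  | _ => trivial

theorem isElementary_subst {τ : ℕ → PTerm L} (hτ : ChannelSubst τ) {X : PTerm L}
    (hX : X.IsElementary) : (X.subst τ).IsElementary := by
  cases X with
  | var i =>
    rcases hτ i with ⟨j, e⟩ | ⟨A, t, e⟩ <;> rw [PTerm.subst, e] <;> trivial
  | _ => trivial

theorem procs_subst (X : PTerm L) : ∀ {τ : ℕ → PTerm L}, ChannelSubst τ →
    (X.subst τ).procs = X.procs := by
  induction X using PTerm.processInduction with
  | elem X hX => intro τ hτ; rw [hX.procs, (isElementary_subst hτ hX).procs]
  | par A B s t hs ht => intro τ hτ; rw [PTerm.subst, PTerm.procs, hs hτ.upS, ht hτ.upS]; rfl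

theorem PCtx.before_subst (C : PCtx L) : ∀ {τ : ℕ → PTerm L}, ChannelSubst τ →
    (C.subst τ).before = C.before := by
  induction C with
  | hole => intro τ _; rfl
  | left A B C t ih => intro τ hτ; exact ih hτ.upS
  | right A B s C ih =>
    intro τ hτ
    rw [PCtx.subst, PCtx.before, PCtx.before, ih hτ.upS, procs_subst s hτ.upS]

theorem CommAt.subst {B : Formula L} {Y X X' : PTerm L} {n : ℕ} {τ : ℕ → PTerm L}
    (hτ : ChannelSubst τ) (h : CommAt B Y X n X') :
    CommAt B (Y.subst (PTerm.upS τ)) (X.subst (PTerm.upS τ)) n (X'.subst (PTerm.upS τ)) := by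
  obtain ⟨C, w, σ, rfl, rfl, rfl⟩ := h
  refine ⟨C.subst (PTerm.upS τ), w.subst (upN C.depth (PTerm.upS τ)),
    σ.map (Frame.subst (upN C.depth (PTerm.upS τ))), ?_,
    (C.before_subst hτ.upS).symm, ?_⟩
  · rw [PCtx.fill_subst, PTerm.plugs_subst, PTerm.subst, PTerm.subst, upN_upS_self,
      PCtx.depth_subst]
  · rw [PCtx.fill_subst, send_subst, PCtx.depth_subst]

theorem StepAt.subst {X : PTerm L} : ∀ {Γ Δ : Ctx L} {X' : PTerm L} {n : ℕ} {τ : ℕ → PTerm L},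
    ChannelSubst τ → (∀ i, HasType .LCstar Δ (τ i) (Γ i)) → StepAt Γ X n X' →
    StepAt Δ (X.subst τ) n (X'.subst τ) := by
  induction X using PTerm.processInduction with
  | elem X hX =>
    intro Γ Δ X' n τ hτ hty h
    rw [stepAt_elementary hX] at h
    rw [stepAt_elementary (isElementary_subst hτ hX)]
    obtain ⟨rfl, ⟨h, ξ, σ, r, rfl, e, rfl⟩ | ⟨A, B, t, σ, T, rfl, h1, h2, rfl⟩⟩ := h
    · refine ⟨rfl, .inl ⟨h.subst τ, ξ.subst τ, σ.map (Frame.subst τ), r.subst τ,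
        PTerm.plugs_subst _ _ _, ?_, PTerm.plugs_subst _ _ _⟩⟩
      rw [contract_subst _ (isHead_of_contract e), e]; rfl
      rintro i rfl
      cases e
    · exact ⟨rfl, .inr ⟨A, B, _, _, T, PTerm.plugs_subst _ _ _, h1.subst hty, h2.subst hty, rfl⟩⟩
  | par A B s t hs ht =>
    intro Γ Δ X' n τ hτ hty h
    refine stepAt_par.2 ?_
    rcases stepAt_par.1 h with ⟨s', h' | h', rfl⟩ | ⟨t', k, h' | h', rfl, rfl⟩
    · exact .inl ⟨_, .inl (hs hτ.upS (hasType_upS _ hty) h'), rfl⟩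
    · exact .inl ⟨_, .inr (h'.subst hτ), rfl⟩
    · exact .inr ⟨_, k, .inl (ht hτ.upS (hasType_upS _ hty) h'), by rw [procs_subst s hτ.upS], rfl⟩
    · exact .inr ⟨_, k, .inr (h'.subst hτ), by rw [procs_subst s hτ.upS], rfl⟩

theorem upS_eq_var_zero {τ : ℕ → PTerm L} {i : ℕ} (h : upS τ i = .var 0) : i = 0 := by
  cases i with
  | zero => rfl
  | succ i =>
    change (τ i).shift = _ at h
    cases hi : τ i <;> rw [hi] at h <;> cases h

theorem upS_succ_eq_var {τ : ℕ → PTerm L} {i j : ℕ} (h : τ i = .var j) :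
    upS τ (i + 1) = .var (j + 1) := by
  change (τ i).shift = _
  rw [h]; rfl

theorem upS_eq_var_succ {τ : ℕ → PTerm L} {i j : ℕ} (h : upS τ i = .var (j + 1)) :
    ∃ i', i = i' + 1 ∧ τ i' = .var j := by
  cases i with
  | zero => cases h
  | succ i =>
    change (τ i).shift = _ at h
    cases hi : τ i <;> rw [hi] at h <;> cases h
    exact ⟨i, rfl, hi⟩

theorem HasMessage.of_subst {X : PTerm L} : ∀ {n j : ℕ} {τ : ℕ → PTerm L}, ChannelSubst τ →
    HasMessage (X.subst τ) n j → ∃ i, τ i = .var j ∧ HasMessage X n i := by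
  induction X using PTerm.processInduction with
  | elem X hX =>
    intro n j τ hτ hm
    obtain ⟨rfl, w, σ, e⟩ := (hasMessage_elementary (isElementary_subst hτ hX)).1 hm
    obtain ⟨h, σ', hh, rfl⟩ := X.exists_head
    rw [PTerm.plugs_subst] at e
    obtain ⟨e1, e2⟩ := PTerm.head_unique (h' := .var j) (isHead_subst hτ hh) trivial _ _ e
    cases h with
    | var i =>
      refine ⟨i, e1, (hasMessage_elementary hX).2 ⟨rfl, ?_⟩⟩
      rcases σ' with - | ⟨ξ, σ'⟩
      · cases e2
      · cases ξ with
        | app s => exact ⟨s, σ', rfl⟩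
        | _ => cases e2
    | _ => cases e1
  | par A B s t hs ht =>
    intro n j τ hτ hm
    rcases hasMessage_par.1 hm with h | ⟨k, h, rfl⟩
    · obtain ⟨i', e, h⟩ := hs hτ.upS h
      obtain ⟨i, rfl, e'⟩ := upS_eq_var_succ e
      exact ⟨i, e', hasMessage_par.2 (.inl h)⟩
    · obtain ⟨i', e, h⟩ := ht hτ.upS h
      obtain ⟨i, rfl, e'⟩ := upS_eq_var_succ e
      exact ⟨i, e', hasMessage_par.2 (.inr ⟨k, h, by rw [procs_subst s hτ.upS]⟩)⟩

/-- A head redex of `X[τ]` stems from a head redex of `X`, or from a message `a w ρ` of `X` for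
whose channel `a` an abstraction is substituted. -/
theorem StepAt.of_subst {X : PTerm L} : ∀ {Γ Δ : Ctx L} {Z : PTerm L} {n : ℕ} {T : Formula L}
    {τ : ℕ → PTerm L}, ChannelSubst τ → (∀ i, HasType .LCstar Δ (τ i) (Γ i)) →
    HasType .LCstar Γ X T → StepAt Δ (X.subst τ) n Z →
    (∃ X', StepAt Γ X n X') ∨ ∃ i, (∀ j, τ i ≠ .var j) ∧ HasMessage X n i := by
  induction X using PTerm.processInduction with
  | elem X hX =>
    intro Γ Δ Z n T τ hτ hty hT hs
    simp only [stepAt_elementary hX, hasMessage_elementary hX]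
    rw [stepAt_elementary (isElementary_subst hτ hX)] at hs
    obtain ⟨h, σ, hh, rfl⟩ := X.exists_head
    rw [PTerm.plugs_subst] at hs
    obtain ⟨rfl, ⟨h', ξ', σ', r, e, hc, rfl⟩ | ⟨A, B, t, σ', T', e, h1, h2, rfl⟩⟩ := hs
    · obtain ⟨rfl, e2⟩ := PTerm.head_unique (isHead_subst hτ hh) (isHead_of_contract hc) _ _ e
      rcases σ with - | ⟨ξ, σ⟩
      · cases e2
      cases e2
      by_cases hv : ∃ i, h = .var i
      · obtain ⟨i, rfl⟩ := hv
        right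
        rcases hτ i with ⟨j, ej⟩ | ⟨A, t, ej⟩
        · rw [PTerm.subst, ej] at hc; cases hc
        · refine ⟨i, fun j hj => (by rw [ej] at hj; cases hj), rfl, ?_⟩
          rw [PTerm.subst, ej] at hc
          cases ξ with
          | app s => exact ⟨s, σ, rfl⟩
          | _ => cases hc
      · left
        rw [contract_subst (fun i hi => hv ⟨i, hi⟩) hh] at hc
        obtain ⟨r, hr, -⟩ := Option.map_eq_some_iff.1 hc
        exact ⟨_, rfl, .inl ⟨h, ξ, σ, r, rfl, hr, rfl⟩⟩
    · obtain ⟨e1, e2⟩ := PTerm.head_unique (h' := .abort A B) (isHead_subst hτ hh) trivial _ _ e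
      rcases σ with - | ⟨ξ, σ⟩
      · cases e2
      cases h with
      | var i =>
        rcases hτ i with ⟨j, ej⟩ | ⟨A, t, ej⟩ <;>
          · rw [PTerm.subst, ej] at e1; cases e1
      | abort A B =>
        cases ξ with
        | app s =>
          cases e2
          left
          -- Types are unique, so that they match after the substitution only if they did before.
          have hT' := hT.subst hty
          rw [PTerm.plugs_subst] at hT'
          obtain rfl := hT'.unique h1
          obtain ⟨C, hC, -⟩ := hasType_plugs.1
            (show HasType _ _ ((PTerm.app (.abort A B) s).plugs σ) _ from hT)
          cases hC with
          | app _ hs =>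
            obtain rfl := (hs.subst hty).unique h2
            exact ⟨_, rfl, .inr ⟨A, B, s, σ, _, rfl, hT, hs, rfl⟩⟩
        | _ => cases e2
      | _ => cases e1
  | par A B s t hs ht =>
    intro Γ Δ Z n T τ hτ hty hT hst
    cases hT with | par hs1 ht1 =>
    simp only [hasMessage_par]
    have aux : ∀ {s : PTerm L} {n : ℕ}, (∃ i, (∀ j, upS τ i ≠ .var j) ∧ HasMessage s n i) →
        ∃ i, (∀ j, τ i ≠ .var j) ∧ HasMessage s n (i + 1) := by
      rintro s n ⟨i, hi, hm⟩
      cases i with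
      | zero => exact absurd rfl (hi 0)
      | succ i => exact ⟨i, fun j hj => hi _ (upS_succ_eq_var hj), hm⟩
    rcases stepAt_par.1 hst with ⟨s', h | h, -⟩ | ⟨t', k, h | h, rfl, -⟩
    · rcases hs hτ.upS (hasType_upS _ hty) hs1 h with ⟨X', h⟩ | h
      · exact .inl ⟨_, stepAt_par.2 (.inl ⟨X', .inl h, rfl⟩)⟩
      · obtain ⟨i, hi, hm⟩ := aux h
        exact .inr ⟨i, hi, .inl hm⟩
    · obtain ⟨i, e, hm⟩ := h.hasMessage.of_subst hτ.upS
      obtain rfl := upS_eq_var_zero e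
      obtain ⟨X', h⟩ := hm.commAt B t
      exact .inl ⟨_, stepAt_par.2 (.inl ⟨X', .inr h, rfl⟩)⟩
    · rw [procs_subst s hτ.upS]
      rcases ht hτ.upS (hasType_upS _ hty) ht1 h with ⟨X', h⟩ | h
      · exact .inl ⟨_, stepAt_par.2 (.inr ⟨X', k, .inl h, rfl, rfl⟩)⟩
      · obtain ⟨i, hi, hm⟩ := aux h
        exact .inr ⟨i, hi, .inr ⟨k, hm, rfl⟩⟩
    · rw [procs_subst s hτ.upS]
      obtain ⟨i, e, hm⟩ := h.hasMessage.of_subst hτ.upS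
      obtain rfl := upS_eq_var_zero e
      obtain ⟨X', h⟩ := hm.commAt A s
      exact .inl ⟨_, stepAt_par.2 (.inr ⟨X', k, .inr h, rfl, rfl⟩)⟩

/-- Head redexes that start to the left of the hole of `C` do not depend on the elementary
process in the hole. -/
theorem exists_stepAt_fill {p q : PTerm L} (hp : p.IsElementary) (hq : q.IsElementary)
    (C : PCtx L) : ∀ {Γ : Ctx L} {m : ℕ}, m < C.before →
    (∃ Z, StepAt Γ (C.fill p) m Z) → ∃ Z, StepAt Γ (C.fill q) m Z := by
  have procs : ∀ C : PCtx L, (C.fill p).procs = (C.fill q).procs := by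
    intro C
    induction C with
    | hole => rw [PCtx.fill, PCtx.fill, hp.procs, hq.procs]
    | left A B C t ih => simp only [PCtx.fill, PTerm.procs, ih]
    | right A B s C ih => simp only [PCtx.fill, PTerm.procs, ih]
  have message : ∀ (C : PCtx L) (m i : ℕ), m < C.before → HasMessage (C.fill p) m i →
      HasMessage (C.fill q) m i := by
    intro C
    induction C with
    | hole => intro m i h; exact absurd h (Nat.not_lt_zero _)
    | left A B C t ih =>
      intro m i hm h
      rcases hasMessage_par.1 h with h | ⟨k, h', rfl⟩
      · exact hasMessage_par.2 (.inl (ih _ _ hm h))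
      · exact hasMessage_par.2 (.inr ⟨k, h', by rw [procs]⟩)
    | right A B s C ih =>
      intro m i hm h
      rcases hasMessage_par.1 h with h | ⟨k, h', rfl⟩
      · exact hasMessage_par.2 (.inl h)
      · exact hasMessage_par.2 (.inr ⟨k, ih _ _ (Nat.lt_of_add_lt_add_left hm) h', rfl⟩)
  induction C with
  | hole => intro Γ m h; exact absurd h (Nat.not_lt_zero _)
  | left A B C t ih =>
    rintro Γ m hm ⟨Z, h⟩
    rcases stepAt_par.1 h with ⟨s', h | h, -⟩ | ⟨t', k, h, rfl, -⟩
    · obtain ⟨Z, h⟩ := ih hm ⟨_, h⟩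
      exact ⟨_, stepAt_par.2 (.inl ⟨_, .inl h, rfl⟩)⟩
    · obtain ⟨Z, h⟩ := (message C _ _ hm h.hasMessage).commAt B t
      exact ⟨_, stepAt_par.2 (.inl ⟨_, .inr h, rfl⟩)⟩
    · have := C.before_lt_procs p
      change _ < C.before at hm
      omega
  | right A B s C ih =>
    rintro Γ m hm ⟨Z, h⟩
    rcases stepAt_par.1 h with ⟨s', h' | h', -⟩ | ⟨t', k, h' | h', rfl, -⟩
    · exact ⟨_, stepAt_par.2 (.inl ⟨_, .inl h', rfl⟩)⟩
    · obtain ⟨Z, h⟩ := h'.hasMessage.commAt B (C.fill q)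
      exact ⟨_, stepAt_par.2 (.inl ⟨_, .inr h, rfl⟩)⟩
    · obtain ⟨Z, h⟩ := ih (Nat.lt_of_add_lt_add_left hm) ⟨_, h'⟩
      exact ⟨_, stepAt_par.2 (.inr ⟨_, k, .inl h, rfl, rfl⟩)⟩
    · obtain ⟨Z, h⟩ := (message C _ _ (Nat.lt_of_add_lt_add_left hm) h'.hasMessage).commAt A s
      exact ⟨_, stepAt_par.2 (.inr ⟨_, k, .inr h, rfl, rfl⟩)⟩

/-! ### Head normalizing terms -/

theorem hn_iff {Γ : Ctx L} {t : PTerm L} :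
    HN Γ t ↔ (∃ A, HasType .LCstar Γ t A) ∧ Acc (fun y x => HeadRed Γ x y) t :=
  and_congr Iff.rfl ((not_congr (not_acc_iff_exists_descending_chain
    (r := fun y x => HeadRed Γ x y)).symm).trans not_not)

theorem hn_of_forall_headRed {Γ : Ctx L} {t : PTerm L} {A : Formula L}
    (ht : HasType .LCstar Γ t A) (h : ∀ t', HeadRed Γ t t' → HN Γ t') : HN Γ t :=
  hn_iff.2 ⟨⟨A, ht⟩, .intro _ fun t' h' => (hn_iff.1 (h t' h')).2⟩

theorem hn_of_isHead {Γ : Ctx L} {h : PTerm L} {A : Formula L} (ht : HasType .LCstar Γ h A)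
    (hh : h.IsHead) (he : h.IsElementary) : HN Γ h := by
  refine hn_of_forall_headRed ht ?_
  rintro t' ⟨n, hs, -⟩
  obtain ⟨-, ⟨h', ξ, σ, r, e, hc, -⟩ | ⟨A, B, t, σ, T, e, -⟩⟩ := (stepAt_elementary he).1 hs
  · cases (PTerm.head_unique hh (isHead_of_contract hc) [] _ e).2
  · cases (PTerm.head_unique (h' := .abort A B) hh trivial [] _ e).2

theorem hn_plugs_of_contract {Γ : Ctx L} {h r : PTerm L} {ξ : Frame L} {σ : Stack L}
    {A : Formula L} (ht : HasType .LCstar Γ (h.plugs (ξ :: σ)) A) (hc : contract h ξ = some r)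
    (hr : HN Γ (r.plugs σ)) : HN Γ (h.plugs (ξ :: σ)) := by
  refine hn_of_forall_headRed ht ?_
  rintro t' ⟨n, hs, -⟩
  have hh := isHead_of_contract hc
  have he : (h.plugs (ξ :: σ)).IsElementary := (PTerm.isElementary_plug h ξ).plugs σ
  obtain ⟨-, ⟨h', ξ', σ', r', e, hc', rfl⟩ | ⟨A, B, t, σ', T, e, -⟩⟩ :=
    (stepAt_elementary he).1 hs
  · obtain ⟨rfl, e'⟩ := PTerm.head_unique hh (isHead_of_contract hc') _ _ e
    cases e'
    rw [hc] at hc'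
    cases hc'
    exact hr
  · obtain ⟨rfl, e⟩ := PTerm.head_unique (h' := .abort A B) hh trivial _ _ e
    cases ξ <;> cases hc

/-- Whether the abort constant fires depends on the types only; if it does not, the term is head
normal. -/
theorem hn_abort_plugs {Γ : Ctx L} {A B T : Formula L} {t : PTerm L} {σ : Stack L}
    (hT : HasType .LCstar Γ ((PTerm.app (.abort A B) t).plugs σ) T) (ht : HN Γ t) :
    HN Γ ((PTerm.app (.abort A B) t).plugs σ) := by
  refine hn_of_forall_headRed hT ?_
  rintro t' ⟨n, hs, -⟩
  have he : ((PTerm.app (.abort A B) t).plugs σ).IsElementary :=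
    PTerm.IsElementary.plugs (t := .app (.abort A B) t) trivial σ
  obtain ⟨-, ⟨h', ξ', σ', r', e, hc', rfl⟩ | ⟨A', B', t', σ', T, e, -, -, rfl⟩⟩ :=
    (stepAt_elementary he).1 hs
  · obtain ⟨rfl, -⟩ := PTerm.head_unique (h := .abort A B) (σ := .app t :: σ) trivial
      (isHead_of_contract hc') _ e
    cases ξ' <;> cases hc'
  · obtain ⟨-, e⟩ := PTerm.head_unique (h := .abort A B) (h' := .abort A' B') (σ := .app t :: σ)
      trivial trivial _ e
    cases e
    exact ht

/-! ### Tests and realizers -/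

theorem realizes_iff {Γ : Ctx L} {t : PTerm L} {C : Formula L} :
    Realizes Γ t C ↔ HasType .LCstar Γ t C ∧ ∀ σ, IsTest Γ σ C → HN Γ (t.plugs σ) := by
  rw [Realizes]

theorem isTest_imp {Γ : Ctx L} {τ : Stack L} {A B : Formula L} :
    IsTest Γ τ (.imp A B) ↔
      τ = [] ∨ ∃ s σ, τ = .app s :: σ ∧ Realizes Γ s A ∧ IsTest Γ σ B := by
  rw [IsTest]

theorem isTest_and {Γ : Ctx L} {τ : Stack L} {A B : Formula L} :
    IsTest Γ τ (.and A B) ↔ τ = [] ∨ (∃ σ, τ = .fst :: σ ∧ IsTest Γ σ A) ∨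
      (∃ σ, τ = .snd :: σ ∧ IsTest Γ σ B) := by
  rw [IsTest]

theorem isTest_or {Γ : Ctx L} {τ : Stack L} {A B : Formula L} :
    IsTest Γ τ (.or A B) ↔ τ = [] ∨ ∃ w₁ w₂ σ, τ = .orElim A w₁ B w₂ :: σ ∧
      Adapted Γ (.or A B) τ ∧
      ∀ t, (Realizes Γ t A → HN Γ ((w₁.inst t).plugs σ)) ∧
        (Realizes Γ t B → HN Γ ((w₂.inst t).plugs σ)) := by
  rw [IsTest]

theorem isTest_all {Γ : Ctx L} {τ : Stack L} {A : Formula L} :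
    IsTest Γ τ (.all A) ↔ τ = [] ∨ ∃ (m : L.Term ℕ) (σ : Stack L), τ = .iapp m :: σ ∧
      IsTest Γ σ (A.inst m) := by
  rw [IsTest]

theorem isTest_ex {Γ : Ctx L} {τ : Stack L} {A : Formula L} :
    IsTest Γ τ (.ex A) ↔ τ = [] ∨ ∃ w σ, τ = .unpack A w :: σ ∧ Adapted Γ (.ex A) τ ∧
      ∀ (m : L.Term ℕ) (t : PTerm L), Realizes Γ t (A.inst m) →
        HN Γ (((w.instI m).inst t).plugs σ) := by
  rw [IsTest]

theorem isTest_of_isAtomic {Γ : Ctx L} {τ : Stack L} {P : Formula L} (hP : P.IsAtomic) :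
    IsTest Γ τ P ↔ τ = [] := by
  cases P <;> first | exact hP.elim | rw [IsTest]

theorem Realizes.hasType {Γ : Ctx L} {t : PTerm L} {C : Formula L} (h : Realizes Γ t C) :
    HasType .LCstar Γ t C := (realizes_iff.1 h).1

theorem Realizes.hn_plugs {Γ : Ctx L} {t : PTerm L} {C : Formula L} (h : Realizes Γ t C)
    {σ : Stack L} (hσ : IsTest Γ σ C) : HN Γ (t.plugs σ) := (realizes_iff.1 h).2 σ hσ

/-- The abort constants inhabit every type of `LC*`, so that adaptedness is not vacuous. -/
theorem Adapted.stackType {Γ : Ctx L} {C : Formula L} {σ : Stack L} (h : Adapted Γ C σ) :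
    ∃ D, StackType .LCstar Γ σ C D := by
  have h0 : HasType .LCstar Γ (.app (.abort (.imp .bot .bot) C) (.lam .bot (.var 0))) C :=
    .app (.abort _ _ _ rfl) (.lam (.var (scons .bot Γ) 0))
  obtain ⟨D, hD⟩ := h _ h0
  obtain ⟨C', h1, h2⟩ := hasType_plugs.1 hD
  obtain rfl := h0.unique h1
  exact ⟨D, h2⟩

theorem IsTest.stackType {Γ : Ctx L} {σ : Stack L} {C : Formula L} (h : IsTest Γ σ C) :
    ∃ D, StackType .LCstar Γ σ C D := by
  cases C with
  | bot => rw [isTest_of_isAtomic (P := .bot) trivial] at h; subst h; exact ⟨_, .nil _⟩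
  | rel P ms => rw [isTest_of_isAtomic (P := .rel P ms) trivial] at h; subst h; exact ⟨_, .nil _⟩
  | and A B =>
    rcases isTest_and.1 h with rfl | ⟨σ, rfl, hσ⟩ | ⟨σ, rfl, hσ⟩
    · exact ⟨_, .nil _⟩
    · obtain ⟨D, hD⟩ := hσ.stackType
      exact ⟨D, .cons (.fst A B) hD⟩
    · obtain ⟨D, hD⟩ := hσ.stackType
      exact ⟨D, .cons (.snd A B) hD⟩
  | or A B =>
    rcases isTest_or.1 h with rfl | ⟨w₁, w₂, σ, rfl, ha, -⟩
    · exact ⟨_, .nil _⟩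
    · exact ha.stackType
  | imp A B =>
    rcases isTest_imp.1 h with rfl | ⟨s, σ, rfl, hs, hσ⟩
    · exact ⟨_, .nil _⟩
    · obtain ⟨D, hD⟩ := hσ.stackType
      exact ⟨D, .cons (.app B hs.hasType) hD⟩
  | all A =>
    rcases isTest_all.1 h with rfl | ⟨m, σ, rfl, hσ⟩
    · exact ⟨_, .nil _⟩
    · obtain ⟨D, hD⟩ := hσ.stackType
      exact ⟨D, .cons (.iapp m A) hD⟩
  | ex A =>
    rcases isTest_ex.1 h with rfl | ⟨w, σ, rfl, ha, -⟩
    · exact ⟨_, .nil _⟩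
    · exact ha.stackType
termination_by C.size
decreasing_by all_goals (subst_vars; simp only [Formula.size, Formula.size_inst]; omega)

theorem IsTest.hasType_plugs {Γ : Ctx L} {σ : Stack L} {C : Formula L} {t : PTerm L}
    (h : IsTest Γ σ C) (ht : HasType .LCstar Γ t C) : ∃ D, HasType .LCstar Γ (t.plugs σ) D :=
  let ⟨D, hD⟩ := h.stackType
  ⟨D, DummettLC.hasType_plugs.2 ⟨C, ht, hD⟩⟩

theorem IsTest.hn_plugs_of_contract {Γ : Ctx L} {h r : PTerm L} {ξ : Frame L} {σ : Stack L}
    {C : Formula L} (hσ : IsTest Γ (ξ :: σ) C) (ht : HasType .LCstar Γ h C)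
    (hc : contract h ξ = some r) (hr : HN Γ (r.plugs σ)) : HN Γ (h.plugs (ξ :: σ)) :=
  let ⟨_, hD⟩ := hσ.hasType_plugs ht
  DummettLC.hn_plugs_of_contract hD hc hr

/-! ### Parallel composition -/

theorem realizes_lam_shift {Γ : Ctx L} {A s} (B : Formula L) (hs : Realizes Γ s A) :
    Realizes Γ (.lam B s.shift) (.imp B A) := by
  have ht : HasType .LCstar Γ (.lam B s.shift) (.imp B A) := .lam (hs.hasType.shift B)
  refine realizes_iff.2 ⟨ht, fun σ hσ => ?_⟩
  rcases isTest_imp.1 hσ with rfl | ⟨b, σ, rfl, -, hσ'⟩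
  · exact hn_of_isHead ht trivial trivial
  · refine hσ.hn_plugs_of_contract ht rfl ?_
    rw [PTerm.shift_inst]
    exact hs.hn_plugs hσ'

/-- The term `λ x^A 𝒜^{C → B} (Y[λ y^B x / a])`. If it is substituted for the channel `a` in a
term of type `C`, then a message `a w ρ` head reduces to `𝒜 (Y[λ y^B w / a]) ρ` and on to
`Y[λ y^B w / a]`, which is what the message becomes in parallel with `Y`. -/
def channel (A B C : Formula L) (Y : PTerm L) : PTerm L :=
  .lam A (.app (.abort C B) (send 0 B (.var 0) Y))

theorem hasType_channel {Γ : Ctx L} {A B C : Formula L} {Y : PTerm L}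
    (hY : HasType .LCstar (scons (.imp B A) Γ) Y C) :
    HasType .LCstar Γ (channel A B C Y) (.imp A B) := by
  refine .lam (.app (.abort _ _ _ rfl) (hY.subst fun i => ?_))
  cases i with
  | zero => exact .lam (.var (scons B (scons A Γ)) 1)
  | succ i => exact .var (scons A Γ) (i + 1)

/-- The term received through `a` in a parallel context of depth `k` is, after the substitution of
the channel term for `a`, the term that the channel term aborts with. -/
theorem send_subst_channel (k : ℕ) (A B C : Formula L) (w Y : PTerm L) :
    (send k B w Y).subst (upN k (scons (channel A B C Y) PTerm.var)) =
      ((send 0 B (.var 0) Y).rename (PTerm.upRen (· + k))).inst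
        (w.subst (upN k (scons (channel A B C Y) PTerm.var))) := by
  simp only [send, PTerm.inst, PTerm.subst_subst, PTerm.subst_rename]
  congr 1
  funext i
  cases i with
  | zero =>
    simp only [scons, PTerm.subst, PTerm.rename]
    rw [PTerm.shift_subst_upS]; rfl
  | succ i =>
    have := upN_add k (scons (channel A B C Y) PTerm.var) (i + 1)
    change upN k _ (i + (k + 1)) = .var (i + k)
    rw [show i + (k + 1) = i + 1 + k by omega, this]
    rfl

theorem send_inst (B : Formula L) (s Y : PTerm L) :
    (send 0 B (.var 0) Y).inst s = Y.inst (.lam B s.shift) := by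
  simp only [send, PTerm.inst, PTerm.subst_subst]
  congr 1
  funext i
  cases i <;> rfl

theorem realizes_channel {Γ : Ctx L} {A B C : Formula L} {Y : PTerm L}
    (hY : HasType .LCstar (scons (.imp B A) Γ) Y C)
    (h : ∀ s, Realizes Γ s A → HN Γ (Y.inst (.lam B s.shift))) :
    Realizes Γ (channel A B C Y) (.imp A B) := by
  have ht := hasType_channel hY
  refine realizes_iff.2 ⟨ht, fun σ hσ => ?_⟩
  rcases isTest_imp.1 hσ with rfl | ⟨s, σ, rfl, hs, hσ'⟩
  · exact hn_of_isHead ht trivial trivial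
  · refine hσ.hn_plugs_of_contract ht rfl ?_
    have hM : HasType .LCstar Γ (Y.inst (.lam B s.shift)) C := hY.inst (.lam (hs.hasType.shift B))
    obtain ⟨D, hD⟩ := hσ'.hasType_plugs
      (HasType.app (.abort Γ C B (rfl : System.LCstar = _)) hM)
    change HN Γ ((PTerm.app (.abort C B) ((send 0 B (.var 0) Y).inst s)).plugs σ)
    rw [send_inst]
    exact hn_abort_plugs hD (h s hs)

/-- The steps that `X` makes in parallel with `Y` are simulated by head reduction of `X` with
`channel A B C Y` substituted for the channel. -/
theorem SideStep.transGen_headRed {Γ : Ctx L} {A B C : Formula L} {X Y X' : PTerm L} {n : ℕ}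
    (h : SideStep (scons (.imp A B) Γ) B Y X n X')
    (hX : HasType .LCstar (scons (.imp A B) Γ) X C)
    (hY : HasType .LCstar (scons (.imp B A) Γ) Y C)
    (hmin : ∀ m < n, ∀ Z, ¬ SideStep (scons (.imp A B) Γ) B Y X m Z) :
    Relation.TransGen (fun y x => HeadRed Γ x y) (X'.inst (channel A B C Y))
      (X.inst (channel A B C Y)) := by
  have hτ : ChannelSubst (scons (channel A B C Y) PTerm.var) := channelSubst_scons_lam _ _
  have hty : ∀ i, HasType .LCstar Γ (scons (channel A B C Y) PTerm.var i)
      (scons (.imp A B) Γ i) := by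
    intro i
    cases i with
    | zero => exact hasType_channel hY
    | succ i => exact .var Γ i
  have hmin' : ∀ m < n, ∀ Z, ¬ StepAt Γ (X.inst (channel A B C Y)) m Z := by
    intro m hm Z hZ
    rcases hZ.of_subst hτ hty hX with ⟨X', h⟩ | ⟨i, hi, h⟩
    · exact hmin m hm _ (.inl h)
    · cases i with
      | zero =>
        obtain ⟨Z, h⟩ := h.commAt B Y
        exact hmin m hm _ (.inr h)
      | succ i => exact hi i rfl
  rcases h with h | ⟨D, w, σ, rfl, rfl, rfl⟩
  · exact .single ⟨n, h.subst hτ hty, hmin'⟩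
  · have hXT := hX.inst (hasType_channel hY)
    have hX' : (D.fill ((PTerm.app (.var D.depth) w).plugs σ)).inst (channel A B C Y) =
        (D.subst (scons (channel A B C Y) PTerm.var)).fill
          ((PTerm.app ((channel A B C Y).rename (· + D.depth))
            (w.subst (upN D.depth (scons (channel A B C Y) PTerm.var)))).plugs
            (σ.map (Frame.subst (upN D.depth (scons (channel A B C Y) PTerm.var))))) := by
      have := upN_add D.depth (scons (channel A B C Y) PTerm.var) 0
      rw [Nat.zero_add] at this
      rw [PTerm.inst, PCtx.fill_subst, PTerm.plugs_subst, PTerm.subst, PTerm.subst, this]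
      rfl
    have hZ : (D.fill (send D.depth B w Y)).inst (channel A B C Y) =
        (D.subst (scons (channel A B C Y) PTerm.var)).fill
          (((send 0 B (.var 0) Y).rename (PTerm.upRen (· + D.depth))).inst
            (w.subst (upN D.depth (scons (channel A B C Y) PTerm.var)))) := by
      rw [PTerm.inst, PCtx.fill_subst, send_subst_channel]
    have hb := (D.before_subst hτ).symm
    rw [hX'] at hXT hmin' ⊢
    rw [hZ]
    rw [hb] at hmin'
    generalize w.subst (upN D.depth (scons (channel A B C Y) PTerm.var)) = w' at *
    generalize List.map _ σ = σ' at *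
    generalize D.subst (scons (channel A B C Y) PTerm.var) = D' at *
    -- The message makes a `β`-step, and then the abort constant discards the rest of its process.
    have h1 : StepAt Γ (D'.fill ((PTerm.app ((channel A B C Y).rename (· + D.depth)) w').plugs σ'))
        D'.before (D'.fill ((PTerm.app (.abort C B)
          (((send 0 B (.var 0) Y).rename (PTerm.upRen (· + D.depth))).inst w')).plugs σ')) :=
      ⟨D', _, _, 0, rfl, .basic σ' (.beta A _ w'), rfl, rfl⟩
    have ht := D'.hasType_of_fill (h1.hasType hXT)
    obtain ⟨E, hE, -⟩ := hasType_plugs.1 ht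
    cases hE with
    | app ha hM =>
      cases ha
      refine .head (b := D'.fill _) ⟨D'.before, ⟨D', _, _, 0, rfl,
        .abort C B _ σ' C ht hM, rfl, rfl⟩, ?_⟩ (.single ⟨_, h1, hmin'⟩)
      intro m hm Z hZ
      obtain ⟨Z', hZ'⟩ := exists_stepAt_fill 
        (PTerm.IsElementary.plugs (t := .app (.abort C B) _) trivial σ')
        (PTerm.IsElementary.plugs (t := .app (.lam A _) w') trivial σ') D' hm ⟨Z, hZ⟩
      exact hmin' m hm Z' hZ'

theorem headRed_par {Γ : Ctx L} {A B : Formula L} {U V Z : PTerm L}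
    (h : HeadRed Γ (.par A B U V) Z) :
    (∃ n U', SideStep (scons (.imp A B) Γ) B V U n U' ∧
      (∀ m < n, ∀ U'', ¬ SideStep (scons (.imp A B) Γ) B V U m U'') ∧ Z = .par A B U' V) ∨
    ((∀ n U', ¬ SideStep (scons (.imp A B) Γ) B V U n U') ∧
      ∃ n V', SideStep (scons (.imp B A) Γ) A U V n V' ∧
      (∀ m < n, ∀ V'', ¬ SideStep (scons (.imp B A) Γ) A U V m V'') ∧ Z = .par A B U V') := by
  obtain ⟨n, hs, hmin⟩ := h
  rcases stepAt_par.1 hs with ⟨U', h, rfl⟩ | ⟨V', k, h, rfl, rfl⟩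
  · exact .inl ⟨n, U', h, fun m hm U'' h'' =>
      hmin m hm _ (stepAt_par.2 (.inl ⟨U'', h'', rfl⟩)), rfl⟩
  · refine .inr ⟨fun m U' h' => ?_, k, V', h, fun m hm V'' h'' => ?_, rfl⟩
    · exact hmin m (Nat.lt_add_right _ h'.lt_procs) _ (stepAt_par.2 (.inl ⟨U', h', rfl⟩))
    · exact hmin _ (Nat.add_lt_add_left hm _) _ (stepAt_par.2 (.inr ⟨V'', m, h'', rfl, rfl⟩))

/-- Once the left component `U` makes no steps, the right component can be studied with `U`
fixed. -/
theorem acc_par_of_left_normal {Γ : Ctx L} {A B C : Formula L} {U : PTerm L}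
    (hU : HasType .LCstar (scons (.imp A B) Γ) U C)
    (hN : ∀ V n U', ¬ SideStep (scons (.imp A B) Γ) B V U n U') {x : PTerm L}
    (hx : Acc (Relation.TransGen fun y x => HeadRed Γ x y) x) :
    ∀ V, HasType .LCstar (scons (.imp B A) Γ) V C → V.inst (channel B A C U) = x →
      Acc (fun y x => HeadRed Γ x y) (PTerm.par A B U V) := by
  induction hx with
  | intro x _ ih =>
    rintro V hV rfl
    refine .intro _ fun Z hZ => ?_
    rcases headRed_par hZ with ⟨n, U', h, -⟩ | ⟨-, n, V', h, hmin, rfl⟩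
    · exact absurd h (hN _ _ _)
    · have hr := h.transGen_headRed hV hU hmin
      exact ih _ hr V' (h.hasType hU hV) rfl

/-- Induction on the head reduction of `U` with the channel term substituted for `a`: the left
component moves until it is normal, and then `acc_par_of_left_normal` takes over. -/
theorem acc_par {Γ : Ctx L} {A B C : Formula L} {V : PTerm L}
    (hV : HasType .LCstar (scons (.imp B A) Γ) V C)
    (h : ∀ s, Realizes Γ s (.imp B A) → HN Γ (V.inst s)) {x : PTerm L}
    (hx : Acc (Relation.TransGen fun y x => HeadRed Γ x y) x) :
    ∀ U, HasType .LCstar (scons (.imp A B) Γ) U C → U.inst (channel A B C V) = x →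
      Acc (fun y x => HeadRed Γ x y) (PTerm.par A B U V) := by
  induction hx with
  | intro x _ ih =>
    rintro U hU rfl
    by_cases hN : ∃ n U', SideStep (scons (.imp A B) Γ) B V U n U'
    · refine .intro _ fun Z hZ => ?_
      rcases headRed_par hZ with ⟨n, U', h, hmin, rfl⟩ | ⟨hN', -⟩
      · have hr := h.transGen_headRed hU hV hmin
        exact ih _ hr U' (h.hasType hV hU) rfl
      · obtain ⟨n, U', h⟩ := hN
        exact absurd h (hN' _ _)
    · have hstep : ∀ n U', ¬ StepAt (scons (.imp A B) Γ) U n U' :=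
        fun n U' h => hN ⟨n, U', .inl h⟩
      have hmsg : ∀ n, ¬ HasMessage U n 0 := fun n h =>
        let ⟨U', h'⟩ := h.commAt B V
        hN ⟨n, U', .inr h'⟩
      refine acc_par_of_left_normal hU (fun W n U' h => ?_)
        (hn_iff.1 (h _ (realizes_channel hU fun s hs => ?_))).2.transGen V hV rfl
      · exact h.elim (hstep n U') fun h => hmsg n h.hasMessage
      -- The left component is normal and sends nothing, so that it stays normal when an
      -- abstraction is substituted for the channel.
      · have ht : HasType .LCstar Γ (.lam A s.shift) (.imp A B) := .lam (hs.hasType.shift A)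
        refine hn_of_forall_headRed (hU.inst ht) ?_
        rintro t' ⟨n, hs, -⟩
        have hty : ∀ i, HasType .LCstar Γ (scons (.lam A s.shift) PTerm.var i)
            (scons (.imp A B) Γ i) := by
          intro i
          cases i with
          | zero => exact ht
          | succ i => exact .var Γ i
        rcases hs.of_subst (channelSubst_scons_lam _ _) hty hU with ⟨U', h⟩ | ⟨i, hi, h⟩
        · exact absurd h (hstep _ _)
        · cases i with
          | zero => exact absurd h (hmsg n)
          | succ i => exact absurd rfl (hi i)

theorem hn_par {Γ : Ctx L} {A B C : Formula L} {U V : PTerm L}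
    (hU : HasType .LCstar (scons (.imp A B) Γ) U C)
    (hV : HasType .LCstar (scons (.imp B A) Γ) V C)
    (hU' : ∀ s, Realizes Γ s (.imp A B) → HN Γ (U.inst s))
    (hV' : ∀ s, Realizes Γ s (.imp B A) → HN Γ (V.inst s)) : HN Γ (.par A B U V) :=
  hn_iff.2 ⟨⟨C, .par hU hV⟩, acc_par hV hV'
    (hn_iff.1 (hU' _ (realizes_channel hV fun _ hs => hV' _ (realizes_lam_shift B hs)))).2.transGen
    U hU rfl⟩

/-- The permutation rules distribute a stack over `∥`. -/
theorem hn_par_plugs {Γ : Ctx L} {A B D : Formula L} (σ : Stack L) : ∀ {U V : PTerm L},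
    HasType .LCstar Γ ((PTerm.par A B U V).plugs σ) D →
    HN Γ (.par A B (U.plugs (σ.map Frame.shift)) (V.plugs (σ.map Frame.shift))) →
    HN Γ ((PTerm.par A B U V).plugs σ) := by
  induction σ with
  | nil => intro U V _ h; exact h
  | cons ξ σ ih =>
    intro U V ht h
    have hc : contract (.par A B U V) ξ = some (.par A B (U.plug ξ.shift) (V.plug ξ.shift)) := by
      cases ξ <;> rfl
    refine hn_plugs_of_contract ht hc (ih ?_ h)
    obtain ⟨C, h1, h2⟩ := hasType_plugs.1
      (show HasType _ _ (((PTerm.par A B U V).plug ξ).plugs σ) _ from ht)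
    exact hasType_plugs.2 ⟨C, (Basic.perm A B U V ξ).hasType h1, h2⟩

theorem realizes_par {Γ : Ctx L} {A B C : Formula L} {u v : PTerm L}
    (ht : HasType .LCstar Γ (.par A B u v) C)
    (hu : ∀ s, Realizes Γ s (.imp A B) → Realizes Γ (u.inst s) C)
    (hv : ∀ s, Realizes Γ s (.imp B A) → Realizes Γ (v.inst s) C) :
    Realizes Γ (.par A B u v) C := by
  refine realizes_iff.2 ⟨ht, fun σ hσ => ?_⟩
  obtain ⟨D, hD⟩ := hσ.stackType
  refine hn_par_plugs σ (hasType_plugs.2 ⟨C, ht, hD⟩) ?_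
  cases ht with
  | par h1 h2 =>
    refine hn_par (hasType_plugs.2 ⟨C, h1, hD.shift _⟩) (hasType_plugs.2 ⟨C, h2, hD.shift _⟩)
      (fun s hs => ?_) fun s hs => ?_
    · rw [PTerm.plugs_shift_inst]; exact (hu s hs).hn_plugs hσ
    · rw [PTerm.plugs_shift_inst]; exact (hv s hs).hn_plugs hσ

/-! ### Adequacy -/

theorem HasType.substI_subst {Γ Θ : Ctx L} {w : PTerm L} {A : Formula L}
    (hw : HasType .LC Γ w A) {r : ℕ → L.Term ℕ} {τ : ℕ → PTerm L}
    (hτ : ∀ i ∈ w.fv, Realizes Θ (τ i) ((Γ i).subst r)) :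
    HasType .LCstar Θ ((w.substI r).subst τ) (A.subst r) :=
  (hw.toLCstar.substI r).subst_of_fv fun i hi =>
    (hτ i (by rwa [PTerm.fv_substI] at hi)).hasType

theorem realizes_scons {Γ Θ : Ctx L} {w s : PTerm L} {A : Formula L} {r : ℕ → L.Term ℕ}
    {τ : ℕ → PTerm L} (hs : Realizes Θ s (A.subst r))
    (hτ : ∀ i, i + 1 ∈ w.fv → Realizes Θ (τ i) ((Γ i).subst r)) :
    ∀ i ∈ w.fv, Realizes Θ (scons s τ i) ((scons A Γ i).subst r) := by
  intro i hi
  cases i with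
  | zero => exact hs
  | succ i => exact hτ i hi

theorem adequacy {Γ : Ctx L} {w : PTerm L} {A : Formula L} (hw : HasType .LC Γ w A) :
    ∀ {Θ : Ctx L} {r : ℕ → L.Term ℕ} {τ : ℕ → PTerm L},
      (∀ i ∈ w.fv, Realizes Θ (τ i) ((Γ i).subst r)) →
      Realizes Θ ((w.substI r).subst τ) (A.subst r) := by
  induction hw with
  | var Γ i => intro Θ r τ hτ; exact hτ i rfl
  | pair h1 h2 ih1 ih2 =>
    intro Θ r τ hτ
    have ht := (h1.pair h2).substI_subst hτ
    refine realizes_iff.2 ⟨ht, fun σ hσ => ?_⟩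
    rcases isTest_and.1 hσ with rfl | ⟨σ, rfl, hσ'⟩ | ⟨σ, rfl, hσ'⟩
    · exact hn_of_isHead ht trivial trivial
    · exact hσ.hn_plugs_of_contract ht rfl ((ih1 fun i hi => hτ i (.inl hi)).hn_plugs hσ')
    · exact hσ.hn_plugs_of_contract ht rfl ((ih2 fun i hi => hτ i (.inr hi)).hn_plugs hσ')
  | fst h ih =>
    intro Θ r τ hτ
    exact realizes_iff.2 ⟨h.fst.substI_subst hτ, fun σ hσ =>
      (ih hτ).hn_plugs (σ := .fst :: σ) (isTest_and.2 (.inr (.inl ⟨σ, rfl, hσ⟩)))⟩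
  | snd h ih =>
    intro Θ r τ hτ
    exact realizes_iff.2 ⟨h.snd.substI_subst hτ, fun σ hσ =>
      (ih hτ).hn_plugs (σ := .snd :: σ) (isTest_and.2 (.inr (.inr ⟨σ, rfl, hσ⟩)))⟩
  | app h1 h2 ih1 ih2 =>
    intro Θ r τ hτ
    exact realizes_iff.2 ⟨(h1.app h2).substI_subst hτ, fun σ hσ =>
      (ih1 fun i hi => hτ i (.inl hi)).hn_plugs (σ := .app _ :: σ)
        (isTest_imp.2 (.inr ⟨_, σ, rfl, ih2 fun i hi => hτ i (.inr hi), hσ⟩))⟩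
  | lam h ih =>
    intro Θ r τ hτ
    have ht := h.lam.substI_subst hτ
    refine realizes_iff.2 ⟨ht, fun σ hσ => ?_⟩
    rcases isTest_imp.1 hσ with rfl | ⟨s, σ, rfl, hs, hσ'⟩
    · exact hn_of_isHead ht trivial trivial
    · refine hσ.hn_plugs_of_contract ht rfl ?_
      rw [PTerm.subst_upS_inst]
      exact (ih (realizes_scons hs hτ)).hn_plugs hσ'
  | inl h ih =>
    intro Θ r τ hτ
    have ht := h.inl.substI_subst hτ
    refine realizes_iff.2 ⟨ht, fun σ hσ => ?_⟩
    rcases isTest_or.1 hσ with rfl | ⟨w₁, w₂, σ, rfl, -, h'⟩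
    · exact hn_of_isHead ht trivial trivial
    · exact hσ.hn_plugs_of_contract ht rfl ((h' _).1 (ih hτ))
  | inr h ih =>
    intro Θ r τ hτ
    have ht := h.inr.substI_subst hτ
    refine realizes_iff.2 ⟨ht, fun σ hσ => ?_⟩
    rcases isTest_or.1 hσ with rfl | ⟨w₁, w₂, σ, rfl, -, h'⟩
    · exact hn_of_isHead ht trivial trivial
    · exact hσ.hn_plugs_of_contract ht rfl ((h' _).2 (ih hτ))
  | orElim h h1 h2 ih ih1 ih2 =>
    intro Θ r τ hτ
    have ht := (h.orElim h1 h2).substI_subst hτ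
    refine realizes_iff.2 ⟨ht, fun σ hσ => ?_⟩
    obtain ⟨D, hD⟩ := hσ.stackType
    refine (ih fun i hi => hτ i (.inl (.inl hi))).hn_plugs (σ := .orElim _ _ _ _ :: σ)
      (isTest_or.2 (.inr ⟨_, _, σ, rfl, ?_, fun s => ⟨fun hs => ?_, fun hs => ?_⟩⟩))
    · cases ht with
      | orElim _ ht1 ht2 => exact fun t ht => ⟨D, hasType_plugs.2 ⟨_, ht, .cons (.orElim ht1 ht2) hD⟩⟩
    · rw [PTerm.subst_upS_inst]
      exact (ih1 (realizes_scons hs fun i hi => hτ i (.inl (.inr hi)))).hn_plugs hσ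
    · rw [PTerm.subst_upS_inst]
      exact (ih2 (realizes_scons hs fun i hi => hτ i (.inr hi))).hn_plugs hσ
  | iapp m h ih =>
    intro Θ r τ hτ
    refine realizes_iff.2 ⟨(h.iapp m).substI_subst hτ, fun σ hσ => ?_⟩
    rw [Formula.inst_subst] at hσ
    exact (ih hτ).hn_plugs (σ := .iapp _ :: σ) (isTest_all.2 (.inr ⟨_, σ, rfl, hσ⟩))
  | ilam h ih =>
    intro Θ r τ hτ
    have ht := h.ilam.substI_subst hτ
    refine realizes_iff.2 ⟨ht, fun σ hσ => ?_⟩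
    rcases isTest_all.1 hσ with rfl | ⟨m, σ, rfl, hσ'⟩
    · exact hn_of_isHead ht trivial trivial
    · refine hσ.hn_plugs_of_contract ht rfl ?_
      rw [← PTerm.instI_subst, PTerm.substI_upI_instI]
      rw [Formula.subst_upI_inst] at hσ'
      exact (ih fun i hi => by rw [Formula.shift_subst_scons]; exact hτ i hi).hn_plugs hσ'
  | pack m h ih =>
    intro Θ r τ hτ
    have ht := (h.pack m).substI_subst hτ
    refine realizes_iff.2 ⟨ht, fun σ hσ => ?_⟩
    rcases isTest_ex.1 hσ with rfl | ⟨w, σ, rfl, -, h'⟩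
    · exact hn_of_isHead ht trivial trivial
    · refine hσ.hn_plugs_of_contract ht rfl (h' _ _ ?_)
      rw [← Formula.inst_subst]
      exact ih hτ
  | @unpack Γ t w A C h h1 ih ih1 =>
    intro Θ r τ hτ
    have ht := (h.unpack h1).substI_subst hτ
    refine realizes_iff.2 ⟨ht, fun σ hσ => ?_⟩
    obtain ⟨D, hD⟩ := hσ.stackType
    refine (ih fun i hi => hτ i (.inl hi)).hn_plugs (σ := .unpack _ _ :: σ)
      (isTest_ex.2 (.inr ⟨_, σ, rfl, ?_, fun m s hs => ?_⟩))
    · cases ht with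
      | unpack _ ht1 => exact fun t ht => ⟨D, hasType_plugs.2 ⟨_, ht, .cons (.unpack ht1) hD⟩⟩
    · have hup : upS (fun i => (τ i).shiftI) = fun i => (upS τ i).shiftI :=
        (PTerm.upS_substI τ _).symm
      rw [hup, ← PTerm.instI_subst, PTerm.substI_upI_instI, PTerm.subst_upS_inst]
      rw [Formula.subst_upI_inst] at hs
      have := ih1 (Θ := Θ) (realizes_scons hs fun i hi => by
        rw [Formula.shift_subst_scons]; exact hτ i (.inr hi))
      rw [Formula.shift_subst_scons] at this
      exact this.hn_plugs hσ
  | par h1 h2 ih1 ih2 =>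
    intro Θ r τ hτ
    refine realizes_par ((h1.par h2).substI_subst hτ) (fun s hs => ?_) fun s hs => ?_
    · rw [PTerm.subst_upS_inst]
      exact ih1 (realizes_scons hs fun i hi => hτ i (.inl hi))
    · rw [PTerm.subst_upS_inst]
      exact ih2 (realizes_scons hs fun i hi => hτ i (.inr hi))
  | efq hP h ih =>
    intro Θ r τ hτ
    have ht := (h.efq hP).substI_subst hτ
    refine realizes_iff.2 ⟨ht, fun σ hσ => ?_⟩
    rw [isTest_of_isAtomic (hP.subst r)] at hσ
    subst hσ
    exact hn_of_isHead ht trivial trivial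
  | abort Γ A B hS => cases hS

end DummettLC

theorem mainTheorem1 {L : FirstOrder.Language} (Γ Θ : DummettLC.Ctx L) (w : DummettLC.PTerm L)
    (A : DummettLC.Formula L) (hw : DummettLC.HasType DummettLC.System.LC Γ w A)
    (r : ℕ → L.Term ℕ) (t : ℕ → DummettLC.PTerm L)
    (ht : ∀ i ∈ w.fv, DummettLC.Realizes Θ (t i) ((Γ i).subst r)) :
    DummettLC.Realizes Θ ((w.substI r).subst t) (A.subst r) :=
  DummettLC.adequacy hw ht
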